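/- Let $k\ge 0$ be an integer and let $\mathcal T_k$ be the set of the following $2+4k$ triangles on $\{0,1,\dots,6k+3\}$: $$[0,2i+1,3k+3+i],\quad [0,2i+2,3k+3+i],\quad [0,4k+3+i,6k+3-i],\quad [0,4k+4+i,6k+3-i]\qquad(0\le i<k),$$ together with $[0,2k+2,4k+3]$ and $[0,2k+1,5k+3]$. For $n\ge 7+12k$ let $R_{k,n}$ be the simplicial complex with vertex set $\mathbb Z_n$ whose facets are all translates $\{a+x : x\in t\}$ with $t\in\mathcal T_k$ and $a\in\mathbb Z_n$. Theorem. For every $k\ge 0$ and every $n\ge 7+12k$: 1. $R_{k,n}$ is an $n$-vertex triangulation of the closed orientable surface of genus $g=kn+1$; that is, its geometric realization is a connected compact topological $2$-manifold without boundary, its triangles can be coherently oriented, and its Euler characteristic is $2-2g$. 2. $R_{k,n}$ has vertex-transitive cyclic symmetry: the cyclic group $\mathbb Z_n$ of order $n$, generated by $v\mapsto v+1$, acts on $R_{k,n}$ by simplicial automorphisms and is transitive on the vertices. 3. $R_{k,n}$ is equivelar of type $\{3,6+12k\}$, that is, every vertex has degree $q=6+12k$. Its numbers of vertices, edges and triangles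 are $f=(n,\,3(1+2k)n,\,2(1+2k)n)=(n,\frac{nq}{2},\frac{nq}{3})$, and $g=1+\frac{(q-6)n}{12}$. Moreover: 4. For all $n\ge 7$, $R_{0,n}$ is Altshuler's cyclic torus $T^2(n)$, the complex on $\mathbb Z_n$ given by the $\mathbb Z_n$-orbits of $[0,1,3]$ and $[0,2,3]$. 5. For all $k\ge 0$, $R_{k,7+12k}$ is neighborly (any two vertices are joined by an edge) and equals the member with $7+12k$ vertices of Ringel's cyclic series. The latter is the complex on $\mathbb Z_{7+12k}$ with triangles $\{c,c+a,c+b\}$, where $c\in\mathbb Z_{7+12k}$ and $a,b$ are consecutive entries of the closed walk, starting with the arc $1$, in Ringel's current graph. This is the cubic directed graph with arcs labelled $1,\dots,6k+3$ whose vertices have, in the cyclic order of the rotation, the outgoing currents (an arc $m$ entering a vertex counts as $-m$) $$(3k+2-i,\,-(3k+3+i),\,2i+1),\quad (3k+3+i,\,-(3k+1-i),\,-(2i+2)),$$ $$(5k+4+i,\,-(2i+1),\,-(5k+3-i)),\quad (5k+2-i,\,2i+2,\,-(5k+4+i))\qquad(0\le i<k),$$ $$(2k+2,\,2k+1,\,-(4k+3)),\quad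 (5k+3,\,-(3k+2),\,-(2k+1)).$$ The walk arrives at a vertex along an arc, leaves it along the next arc in the cyclic order at that vertex, and records the label of each arc traversed forwards and the negative of the label of each arc traversed backwards. -/

import Mathlib

/-! ### Simplicial complexes, their realizations, and triangulated surfaces -/

section Complexes

variable {V : Type*}

/-- The geometric realization of a finite simplicial complex, in barycentric coordinates, as a
subset of `V → ℝ`: the convex combinations of the vertices of a face. It carries the subspace
topology of the product topology. -/
def geomRealization (K : PreAbstractSimplicialComplex V) : Set (V → ℝ) :=
  {x | (∀ v, 0 ≤ x v) ∧ ∃ s ∈ K.faces, (∀ v, v ∉ s → x v = 0) ∧ ∑ v ∈ s, x v = 1}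

/-- `faceCount K i` is `f_i`, the number of `i`-dimensional faces (those with `i + 1` vertices). -/
noncomputable def faceCount (K : PreAbstractSimplicialComplex V) (i : ℕ) : ℕ :=
  {s : Finset V | s ∈ K.faces ∧ s.card = i + 1}.ncard

/-- The Euler characteristic `f_0 - f_1 + f_2` of a complex of dimension at most two. -/
noncomputable def eulerCharTwo (K : PreAbstractSimplicialComplex V) : ℤ :=
  (faceCount K 0 : ℤ) - (faceCount K 1 : ℤ) + (faceCount K 2 : ℤ)

/-- The degree of a vertex in the 1-skeleton. -/
noncomputable def vertexDegree [DecidableEq V] (K : PreAbstractSimplicialComplex V) (v : V) : ℕ :=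
  {w : V | w ≠ v ∧ {v, w} ∈ K.faces}.ncard

/-- All vertices have degree `q`. For a triangulated surface this says that the triangulation is
equivelar of type `{3, q}`. -/
def IsEquivelar [DecidableEq V] (K : PreAbstractSimplicialComplex V) (q : ℕ) : Prop :=
  ∀ v, {v} ∈ K.faces → vertexDegree K v = q

/-- Any two vertices are joined by an edge. -/
def IsNeighborly [DecidableEq V] (K : PreAbstractSimplicialComplex V) : Prop :=
  ∀ v w, {v} ∈ K.faces → {w} ∈ K.faces → v ≠ w → {v, w} ∈ K.faces

/-- A coherent orientation of the triangles of `K`. `O a b c` says that `a → b → c → a` is the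
chosen cyclic order of the triangle `{a, b, c}`. Every triangle receives exactly one of its two
cyclic orders, and two different triangles with a common edge `{a, b}` induce opposite
directions on it, i.e. at most one triangle induces `a → b`. -/
structure IsCoherentOrientation [DecidableEq V] (K : PreAbstractSimplicialComplex V)
    (O : V → V → V → Prop) : Prop where
  triangle : ∀ a b c, O a b c → a ≠ b ∧ b ≠ c ∧ a ≠ c ∧ {a, b, c} ∈ K.faces
  rotate : ∀ a b c, O a b c → O b c a
  choice : ∀ a b c, a ≠ b → b ≠ c → a ≠ c → {a, b, c} ∈ K.faces → Xor (O a b c) (O b a c)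
  coherent : ∀ a b c d, O a b c → O a b d → c = d

/-- `K` is a triangulation of the closed orientable surface of genus `g`: a finite simplicial
complex of dimension at most two whose realization is a nonempty connected compact
Hausdorff topological 2-manifold without boundary, which is orientable and has Euler
characteristic `2 - 2g`. -/
structure TriangulatesOrientableSurface [DecidableEq V] (K : PreAbstractSimplicialComplex V)
    (g : ℕ) : Prop where
  finite : K.faces.Finite
  dim_le_two : ∀ s ∈ K.faces, s.card ≤ 3
  compact : CompactSpace (geomRealization K)
  hausdorff : T2Space (geomRealization K)
  connected : ConnectedSpace (geomRealization K)
  manifold : Nonempty (ChartedSpace (EuclideanSpace ℝ (Fin 2)) (geomRealization K))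
  orientable : ∃ O : V → V → V → Prop, IsCoherentOrientation K O
  euler : eulerCharTwo K = 2 - 2 * (g : ℤ)

/-- The group of automorphisms of `K`: the permutations of the vertices that preserve the faces. -/
def automorphisms (K : PreAbstractSimplicialComplex V) : Subgroup (Equiv.Perm V) where
  carrier := {σ | ∀ s : Finset V, s.map σ.toEmbedding ∈ K.faces ↔ s ∈ K.faces}
  one_mem' := by
    intro s
    have : s.map (1 : Equiv.Perm V).toEmbedding = s := Finset.map_refl
    rw [this]
  mul_mem' := by
    intro σ τ hσ hτ s
    have : s.map (σ * τ).toEmbedding = (s.map τ.toEmbedding).map σ.toEmbedding := by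
      rw [Finset.map_map]; rfl
    rw [this, hσ, hτ]
  inv_mem' := by
    intro σ hσ s
    have : (s.map (σ⁻¹).toEmbedding).map σ.toEmbedding = s := by
      ext x
      simp only [Finset.mem_map, Equiv.coe_toEmbedding, exists_exists_and_eq_and]
      simp
    rw [← hσ, this]

end Complexes

/-! ### Cyclic complexes -/

/-- The group of the `n` cyclic shifts of `ZMod n`, generated by the permutation `v ↦ v + 1`. -/
def cyclicShifts (n : ℕ) : Subgroup (Equiv.Perm (ZMod n)) :=
  Subgroup.zpowers (Equiv.addRight (1 : ZMod n))

/-- The simplicial complex on `ZMod n` whose facets are the translates of the members of `T`. -/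
def cyclicComplex (n : ℕ) (T : Set (Finset (ZMod n))) :
    PreAbstractSimplicialComplex (ZMod n) where
  faces := {s | s.Nonempty ∧ ∃ t ∈ T, ∃ a : ZMod n, s ⊆ t.image (fun v => v + a)}
  isRelLowerSet_faces := by
    rintro s ⟨hs, t, ht, a, hst⟩
    exact ⟨hs, fun u hu hne => ⟨hne, t, ht, a, hu.trans hst⟩⟩

/-- The `2 + 4k` generating triangles. Listed in blocks they are
* `[0, 2i+1, 3k+3+i]` and `[0, 2i+2, 3k+3+i]` for `0 ≤ i < k`,
* `[0, 4k+3, 6k+3], [0, 4k+4, 6k+2], …, [0, 5k+2, 5k+4]` (`k` triangles),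
* `[0, 4k+4, 6k+3], [0, 4k+5, 6k+2], …, [0, 5k+3, 5k+4]` (`k` triangles),
* `[0, 2k+2, 4k+3]` and `[0, 2k+1, 5k+3]`.
For `k = 0` only the last two, `[0, 2, 3]` and `[0, 1, 3]`, remain. -/
def generatingTriangles (k : ℕ) : Finset (Finset ℕ) :=
  (Finset.range k).image (fun i => {0, 2 * i + 1, 3 * k + 3 + i}) ∪
  (Finset.range k).image (fun i => {0, 2 * i + 2, 3 * k + 3 + i}) ∪
  (Finset.range k).image (fun i => {0, 4 * k + 3 + i, 6 * k + 3 - i}) ∪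
  (Finset.range k).image (fun i => {0, 4 * k + 4 + i, 6 * k + 3 - i}) ∪
  {{0, 2 * k + 2, 4 * k + 3}, {0, 2 * k + 1, 5 * k + 3}}

/-- The complex `R_{k,n}`. -/
def generalizedRingel (k n : ℕ) : PreAbstractSimplicialComplex (ZMod n) :=
  cyclicComplex n
    {t | ∃ u ∈ generatingTriangles k, t = u.image (fun m : ℕ => (m : ZMod n))}

/-- Altshuler's cyclic torus `T²(n)`, given by the orbits of `[0,1,3]` and `[0,2,3]`. -/
def altshulerTorus (n : ℕ) : PreAbstractSimplicialComplex (ZMod n) :=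
  cyclicComplex n {{0, 1, 3}, {0, 2, 3}}

/-! ### Ringel's cyclic series, by its current graph -/

/-- The rotations of Ringel's cubic current graph with arcs labelled `1, …, 6k+3`.
`RingelNode k x y z` says that some vertex of the graph has outgoing currents `x, y, z`, in this
cyclic order, where an arc with label `m` that enters the vertex has outgoing current `-m`;
the outgoing currents at a vertex sum to zero.

The graph is a ladder with rungs `1, …, 2k`. One side passes through the vertices
`rightEnd, v_1, …, v_{2k}, leftEnd`, the other one through `leftEnd, w_{2k}, …, w_1, rightEnd`,
the rung `j` joins `v_j` and `w_j`, and the arc `2k+1` joins the two ends. -/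
inductive RingelNode (k : ℕ) : ℤ → ℤ → ℤ → Prop
  | v_odd (i : ℕ) (hi : i < k) :
      RingelNode k (3 * k + 2 - i) (-(3 * k + 3 + i)) (2 * i + 1)
  | v_even (i : ℕ) (hi : i < k) :
      RingelNode k (3 * k + 3 + i) (-(3 * k + 1 - i)) (-(2 * i + 2))
  | w_odd (i : ℕ) (hi : i < k) :
      RingelNode k (5 * k + 4 + i) (-(2 * i + 1)) (-(5 * k + 3 - i))
  | w_even (i : ℕ) (hi : i < k) :
      RingelNode k (5 * k + 2 - i) (2 * i + 2) (-(5 * k + 4 + i))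
  | leftEnd : RingelNode k (2 * k + 2) (2 * k + 1) (-(4 * k + 3))
  | rightEnd : RingelNode k (5 * k + 3) (-(3 * k + 2)) (-(2 * k + 1))

/-- One step of the walk along the arcs: after an arc with current `a` the walk continues with the
arc that follows it in the rotation at the vertex reached, and `b` is the current along
that arc. -/
def RingelStep (k : ℕ) (a b : ℤ) : Prop :=
  ∃ z, RingelNode k (-a) b z ∨ RingelNode k b z (-a) ∨ RingelNode k z (-a) b

/-- Ringel's cyclic complex with `7 + 12k` vertices. The link of the vertex `0` consists of the
edges `{a, b}` between consecutive currents `a, b` of the walk that starts with the arc `1`, and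
the links of the other vertices are obtained by cyclic shifts. -/
def ringelSeries (k : ℕ) : PreAbstractSimplicialComplex (ZMod (7 + 12 * k)) :=
  cyclicComplex (7 + 12 * k)
    {t | ∃ a b : ℤ, Relation.ReflTransGen (RingelStep k) 1 a ∧ RingelStep k a b ∧
      t = {0, (a : ZMod (7 + 12 * k)), (b : ZMod (7 + 12 * k))}}

/-!
Everything is reduced to the link of the vertex `0`. Suppose that the distinct nonzero elements
`c 0, …, c (m - 1)` of `ZMod n`, cyclically ordered, satisfy Heffter's rule: for every `j` the
elements `c (j + 1) - c j` and `-c j` are again consecutive (`CyclicRotation`). Then the translates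
of the triangles `0, c j, c (j + 1)` at `0` are, at any vertex `v`, just the triangles
`v, v + c j, v + c (j + 1)`; so the link of `v` is the cycle `v + c` of length `m`
(`CyclicRotation.mem_complex_of_mem`). Hence

* the cyclic orders `v → v + c j → v + c (j + 1)` are a coherent orientation
  (`CyclicRotation.isCoherentOrientation`);
* counting directed edges and oriented triangles with a distinguished vertex, of which there are
  `nm` each, gives `f₁ = nm / 2` and `f₂ = nm / 3`;
* the realization is a 2-manifold. The open star of a vertex, with the barycentric coordinates
  divided by the one at the vertex, is the space of the nonnegative functions on the link cycle
  that are supported on an edge; sending the `j`-th link vertex to the `j`-th of the `m`-th roots of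
  unity identifies it with the complete fan spanned by these roots, that is, with the plane
  (`exists_chart_openStar`). The inverse is given by hat functions, each an explicit minimum of two
  determinants (`fanHat_cone`);
* if `1` is one of the `c j`, the realization is connected.

For `R_{k,n}` the cycle `c` is the walk in Ringel's current graph, reduced modulo `n`. Since the
currents at each vertex of that graph sum to zero, the walk obeys Heffter's rule
(`RingelStep.rotate`), and since its currents are at most `6k+3` in absolute value they stay
distinct modulo `n ≥ 12k+7`. That the walk is a single cycle through all `12k+6` currents follows
from an explicit piecewise linear formula for the position of a current in it
(`RingelStep.ringelIndex_eq`, `bijective_ringelIndex`). Finally each vertex of the current graph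
corresponds to one generating triangle, up to translation
(`RingelNode.exists_generatingTriangle`), so `R_{k,n}` is the complex of this rotation, as is
Ringel's complex for `n = 12k+7`.
-/

/-! ### The complete fan spanned by the `m`-th roots of unity -/

section Fan

open Complex

variable {m : ℕ} [NeZero m]

/-- The oriented area `det (z, w)` of the parallelogram spanned by two plane vectors. -/
def planeDet (z w : ℂ) : ℝ := z.re * w.im - z.im * w.re

/-- The hat function of the `i`-th ray of the fan spanned by the `m`-th roots of unity: it is
linear on each cone of the fan, and it takes the value `1` at the `i`-th root of unity and `0` at
the other ones. -/
noncomputable def fanHat (i : ZMod m) (z : ℂ) : ℝ :=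
  max 0 (min (planeDet z (ZMod.toCircle (i + 1))) (planeDet (ZMod.toCircle (i - 1)) z)) /
    Real.sin (2 * Real.pi / m)

lemma continuous_fanHat (i : ZMod m) : Continuous (fanHat i) := by
  unfold fanHat planeDet
  fun_prop

lemma toCircle_natCast_eq (d : ℕ) : (ZMod.toCircle (d : ZMod m) : ℂ) =
    Complex.exp (((2 * Real.pi / m * d : ℝ) : ℂ) * I) := by
  rw [ZMod.toCircle_natCast]
  congr 1
  push_cast
  ring

lemma planeDet_toCircle (i j : ZMod m) :
    planeDet (ZMod.toCircle i) (ZMod.toCircle j) = (ZMod.toCircle (j - i) : ℂ).im := by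
  rw [sub_eq_add_neg, AddChar.map_add_eq_mul, AddChar.map_neg_eq_inv, Circle.coe_mul,
    Circle.coe_inv_eq_conj]
  simp [planeDet, Complex.mul_im]
  ring

lemma planeDet_add_left (a b : ℝ) (z w t : ℂ) :
    planeDet (a * z + b * w) t = a * planeDet z t + b * planeDet w t := by
  simp [planeDet]; ring

lemma planeDet_add_right (a b : ℝ) (z w t : ℂ) :
    planeDet t (a * z + b * w) = a * planeDet t z + b * planeDet t w := by
  simp [planeDet]; ring

lemma toCircle_natCast_im (d : ℕ) :
    (ZMod.toCircle (d : ZMod m) : ℂ).im = Real.sin (2 * Real.pi / m * d) := by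
  rw [toCircle_natCast_eq, Complex.exp_ofReal_mul_I_im]

lemma toCircle_neg_im (d : ZMod m) :
    (ZMod.toCircle (-d) : ℂ).im = - (ZMod.toCircle d : ℂ).im := by
  rw [AddChar.map_neg_eq_inv, Circle.coe_inv_eq_conj, Complex.conj_im]

/-- The cones spanned by consecutive roots of unity cover the plane. -/
lemma exists_mem_fan_cone (hm : 4 ≤ m) (z : ℂ) : ∃ (j : ZMod m) (a b : ℝ), 0 ≤ a ∧ 0 ≤ b ∧
    z = a * ZMod.toCircle j + b * ZMod.toCircle (j + 1) := by
  have hm' : (4 : ℝ) ≤ m := by exact_mod_cast hm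
  set α : ℝ := 2 * Real.pi / m with hα
  have hα0 : 0 < α := by have := Real.pi_pos; positivity
  have hαπ : α < Real.pi := by
    rw [hα, div_lt_iff₀ (by linarith)]
    nlinarith [Real.pi_pos]
  have hs : 0 < Real.sin α := Real.sin_pos_of_pos_of_lt_pi hα0 hαπ
  set θ := z.arg
  -- the cone is the one whose sector contains the argument of `z`, and the law of sines gives the
  -- coefficients
  set j : ℤ := ⌊θ / α⌋ with hj
  have h1 : j * α ≤ θ := by
    rw [← le_div_iff₀ hα0]; exact Int.floor_le _
  have h2 : θ < (j + 1) * α := by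
    rw [← div_lt_iff₀ hα0]; exact Int.lt_floor_add_one _
  have hp : ∀ i : ℤ, (ZMod.toCircle (i : ZMod m) : ℂ) =
      Complex.exp (((i * α : ℝ) : ℂ) * I) := by
    intro i
    rw [ZMod.toCircle_intCast, hα]
    congr 1
    push_cast
    ring
  refine ⟨(j : ZMod m), ‖z‖ * Real.sin ((j + 1) * α - θ) / Real.sin α,
    ‖z‖ * Real.sin (θ - j * α) / Real.sin α, ?_, ?_, ?_⟩
  · refine div_nonneg (mul_nonneg (norm_nonneg _) (Real.sin_nonneg_of_nonneg_of_le_pi ?_ ?_)) hs.le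
      <;> linarith
  · refine div_nonneg (mul_nonneg (norm_nonneg _) (Real.sin_nonneg_of_nonneg_of_le_pi ?_ ?_)) hs.le
      <;> linarith
  · have hj1 : (j : ZMod m) + 1 = ((j + 1 : ℤ) : ZMod m) := by push_cast; rfl
    rw [hj1, hp, hp]
    conv_lhs => rw [← Complex.norm_mul_exp_arg_mul_I z]
    have e1 : ((j + 1 : ℤ) : ℝ) * α = j * α + α := by push_cast; ring
    have e2 : ((j : ℝ) + 1) * α - θ = (j * α + α) - θ := by ring
    rw [e1, e2]
    apply Complex.ext
    · simp only [Complex.re_ofReal_mul, Complex.add_re, Complex.exp_ofReal_mul_I_re]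
      rw [Real.sin_sub, Real.sin_sub, Real.cos_add, Real.sin_add]
      field_simp
      linear_combination (-‖z‖ * Real.sin α * Real.cos θ) * Real.sin_sq_add_cos_sq (j * α)
    · simp only [Complex.im_ofReal_mul, Complex.add_im, Complex.exp_ofReal_mul_I_im]
      rw [Real.sin_sub, Real.sin_sub, Real.cos_add, Real.sin_add]
      field_simp
      linear_combination (-‖z‖ * Real.sin α * Real.sin θ) * Real.sin_sq_add_cos_sq (j * α)

/-- On each cone of the fan the hat functions are the coordinates with respect to the two roots of
unity that span it. -/
lemma fanHat_cone (hm : 4 ≤ m) (i j : ZMod m) {a b : ℝ} (ha : 0 ≤ a) (hb : 0 ≤ b) :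
    fanHat i (a * ZMod.toCircle j + b * ZMod.toCircle (j + 1)) =
      (if i = j then a else 0) + (if i = j + 1 then b else 0) := by
  have hm' : (4 : ℝ) ≤ m := by exact_mod_cast hm
  set α : ℝ := 2 * Real.pi / m with hα
  have hα0 : 0 < α := by have := Real.pi_pos; positivity
  have hmα : α * m = 2 * Real.pi := by rw [hα]; field_simp
  have hαπ : 2 * α ≤ Real.pi := by nlinarith
  have hs : 0 < Real.sin α := Real.sin_pos_of_pos_of_lt_pi hα0 (by linarith)
  have hs2 : 0 ≤ Real.sin (2 * α) := Real.sin_nonneg_of_nonneg_of_le_pi (by linarith) hαπ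
  set S : ZMod m → ℝ := fun d => (ZMod.toCircle d : ℂ).im with hS
  have hSneg : ∀ d, S (-d) = - S d := toCircle_neg_im
  have hSnat : ∀ d : ℕ, S d = Real.sin (α * d) := toCircle_natCast_im
  have hS0 : S 0 = 0 := by simpa using hSnat 0
  have hS1 : S 1 = Real.sin α := by simpa using hSnat 1
  have hS2 : S 2 = Real.sin (2 * α) := by simpa [mul_comm] using hSnat 2
  have : Fact (1 < m) := ⟨by omega⟩
  obtain ⟨d, hd, rfl⟩ : ∃ d : ℕ, d < m ∧ i = j + d :=
    ⟨(i - j).val, ZMod.val_lt _, by simp⟩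
  have key : fanHat (j + (d : ZMod m)) (a * ZMod.toCircle j + b * ZMod.toCircle (j + 1)) =
      max 0 (min (a * S ((d : ZMod m) + 1) + b * S d) (a * S (1 - d) + b * S (2 - d))) /
        Real.sin α := by
    rw [fanHat, planeDet_add_left, planeDet_add_right]
    simp only [planeDet_toCircle]
    rw [show j + (d : ZMod m) + 1 - j = d + 1 by ring,
      show j + (d : ZMod m) + 1 - (j + 1) = d by ring,
      show j - (j + (d : ZMod m) - 1) = 1 - d by ring,
      show j + 1 - (j + (d : ZMod m) - 1) = 2 - d by ring]
  rw [key]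
  have hd0 : j + (d : ZMod m) = j ↔ d = 0 := by
    rw [add_eq_left, ZMod.natCast_eq_zero_iff]
    exact ⟨fun h => Nat.eq_zero_of_dvd_of_lt h hd, fun h => h ▸ dvd_zero m⟩
  have hd1 : j + (d : ZMod m) = j + 1 ↔ d = 1 := by
    rw [add_right_inj]
    refine ⟨fun h => ?_, fun h => by simp [h]⟩
    have := congrArg ZMod.val h
    rwa [ZMod.val_natCast_of_lt hd, ZMod.val_one] at this
  simp only [hd0, hd1]
  rcases Nat.lt_or_ge d 2 with h | h
  · interval_cases d
    · simp only [Nat.cast_zero, zero_add, sub_zero, hS0, hS1, hS2, mul_zero, add_zero]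
      rw [min_eq_left (by nlinarith), max_eq_right (by positivity)]
      simp [hs.ne']
    · have e : (1 : ZMod m) + 1 = 2 := by norm_num
      have e2 : (2 : ZMod m) - 1 = 1 := by ring
      simp only [Nat.cast_one, e, e2, sub_self, hS0, hS1, hS2, mul_zero, zero_add]
      rw [min_eq_right (by nlinarith), max_eq_right (by positivity)]
      simp [hs.ne']
  · rw [if_neg (by omega), if_neg (by omega), max_eq_left, zero_div, add_zero]
    -- On the far side of the ray `i` one of the two determinants is nonpositive, according to
    -- whether the angle `d * α` exceeds `π`.
    have hdR : (d : ℝ) + 1 ≤ m := by exact_mod_cast hd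
    have h2d : (2 : ℝ) ≤ d := by exact_mod_cast h
    rcases le_total Real.pi (α * d) with hπ | hπ
    · refine (min_le_left _ _).trans ?_
      have hneg : ∀ x, Real.pi ≤ x → x ≤ 2 * Real.pi → Real.sin x ≤ 0 := by
        intro x hx1 hx2
        have := Real.sin_nonneg_of_nonneg_of_le_pi (x := x - Real.pi) (by linarith) (by linarith)
        rw [Real.sin_sub_pi] at this
        linarith
      have e : S ((d : ZMod m) + 1) = Real.sin (α * (d + 1)) := by simpa using hSnat (d + 1)
      have l1 : S ((d : ZMod m) + 1) ≤ 0 := by rw [e]; apply hneg <;> nlinarith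
      have l2 : S d ≤ 0 := by rw [hSnat]; apply hneg <;> nlinarith
      nlinarith
    · refine (min_le_right _ _).trans ?_
      have e1 : S (1 - d) = - Real.sin (α * (d - 1)) := by
        rw [← neg_sub, hSneg]
        have := hSnat (d - 1)
        rw [Nat.cast_sub (by omega), Nat.cast_sub (by omega)] at this
        simpa using this
      have e2 : S (2 - d) = - Real.sin (α * (d - 2)) := by
        rw [← neg_sub, hSneg]
        have := hSnat (d - 2)
        rw [Nat.cast_sub (by omega), Nat.cast_sub (by omega)] at this
        simpa using this
      have l1 : 0 ≤ Real.sin (α * (d - 1)) := by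
        apply Real.sin_nonneg_of_nonneg_of_le_pi <;> nlinarith
      have l2 : 0 ≤ Real.sin (α * (d - 2)) := by
        apply Real.sin_nonneg_of_nonneg_of_le_pi <;> nlinarith
      rw [e1, e2]
      nlinarith

lemma fanHat_nonneg (hm : 4 ≤ m) (i : ZMod m) (z : ℂ) : 0 ≤ fanHat i z := by
  obtain ⟨j, a, b, ha, hb, rfl⟩ := exists_mem_fan_cone hm z
  rw [fanHat_cone hm i j ha hb]
  positivity

end Fan

/-! ### Open vertex stars are planes -/

section Star

open Complex

variable {V : Type*} [DecidableEq V] {m : ℕ} [NeZero m]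

/-- If the link of a vertex `v` is a cycle of length at least four, then the open star of `v` in the
geometric realization is homeomorphic to the plane. The homeomorphism divides the barycentric
coordinates by that of `v` and maps the cones over the edges of the link linearly to the
cones spanned by consecutive roots of unity. -/
theorem exists_chart_openStar (hm : 4 ≤ m) (K : PreAbstractSimplicialComplex V) (v : V)
    (l : ZMod m → V) (hl : Function.Injective l) (hlv : ∀ j, l j ≠ v)
    (hK : ∀ s : Finset V, v ∈ s → (s ∈ K.faces ↔ ∃ j, s ⊆ {v, l j, l (j + 1)})) :
    ∃ e : OpenPartialHomeomorph (geomRealization K) ℂ, e.source = {x | 0 < x.1 v} := by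
  have : Fact (1 < m) := ⟨by omega⟩
  have hj1 : ∀ j : ZMod m, j ≠ j + 1 := fun j h => one_ne_zero (left_eq_add.mp h)
  -- a total weight of `1` that is supported on a triangle at `v`
  have hsupp : ∀ x ∈ geomRealization K, 0 < x v → ∃ j, (∀ w, w ≠ v → w ≠ l j → w ≠ l (j + 1) →
      x w = 0) ∧ x v + x (l j) + x (l (j + 1)) = 1 := by
    rintro x ⟨hx0, s, hs, hsx, hsum⟩ hxv
    have hvs : v ∈ s := by
      by_contra h
      exact hxv.ne' (hsx v h)
    obtain ⟨j, hj⟩ := (hK s hvs).1 hs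
    refine ⟨j, fun w h1 h2 h3 => hsx w fun hw => ?_, ?_⟩
    · have := hj hw
      simp [h1, h2, h3] at this
    · rw [← hsum, Finset.sum_subset hj (fun w _ hw => hsx w hw),
        Finset.sum_insert (by simp [(hlv _).symm]), Finset.sum_pair (hl.ne (hj1 j)), add_assoc]
  -- for functions supported on a triangle at `v`, sums over the link reduce to two terms
  have hsumz : ∀ (f : V → ℝ) (j : ZMod m), (∀ w, w ≠ v → w ≠ l j → w ≠ l (j + 1) → f w = 0) →
      ∀ p : ZMod m → ℂ, ∑ i, (f (l i) : ℂ) * p i =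
        f (l j) * p j + f (l (j + 1)) * p (j + 1) := by
    intro f j hf p
    rw [← Finset.sum_pair (f := fun i => (f (l i) : ℂ) * p i) (hj1 j)]
    refine (Finset.sum_subset (Finset.subset_univ _) fun i _ hi => ?_).symm
    simp only [Finset.mem_insert, Finset.mem_singleton, not_or] at hi
    rw [hf _ (hlv i) (hl.ne hi.1) (hl.ne hi.2)]
    simp
  -- `D z` is the reciprocal of the barycentric coordinate at `v`, and `G` is the inverse chart.
  set D : ℂ → ℝ := fun z => 1 + ∑ i : ZMod m, fanHat i z with hD
  have hDpos : ∀ z, 0 < D z := fun z =>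
    add_pos_of_pos_of_nonneg one_pos (Finset.sum_nonneg fun i _ => fanHat_nonneg hm i z)
  have hDc : Continuous D :=
    continuous_const.add (continuous_finsetSum _ fun i _ => continuous_fanHat i)
  set G : ℂ → V → ℝ := fun z w =>
    ((if w = v then 1 else 0) + ∑ i : ZMod m, if l i = w then fanHat i z else 0) / D z with hG
  have hGv : ∀ z, G z v = 1 / D z := by
    intro z
    simp [hG, hlv]
  have hGl : ∀ z i, G z (l i) = fanHat i z / D z := by
    intro z i
    simp [hG, hlv, hl.eq_iff]
  have hG0 : ∀ z w, w ≠ v → (∀ i, l i ≠ w) → G z w = 0 := by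
    intro z w h1 h2
    simp [hG, h1, h2]
  have hDcone : ∀ (j : ZMod m) (a b : ℝ), 0 ≤ a → 0 ≤ b →
      D (a * ZMod.toCircle j + b * ZMod.toCircle (j + 1)) = 1 + (a + b) := by
    intro j a b ha hb
    simp [hD, fanHat_cone hm _ j ha hb, Finset.sum_add_distrib]
  have hGmem : ∀ z, G z ∈ geomRealization K := by
    intro z
    refine ⟨fun w => div_nonneg (add_nonneg (by split_ifs <;> norm_num)
      (Finset.sum_nonneg fun i _ => ?_)) (hDpos z).le, ?_⟩
    · split_ifs
      exacts [fanHat_nonneg hm i z, le_rfl]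
    · obtain ⟨j, a, b, ha, hb, rfl⟩ := exists_mem_fan_cone hm z
      refine ⟨{v, l j, l (j + 1)}, (hK _ (by simp)).2 ⟨j, subset_rfl⟩, fun w hw => ?_, ?_⟩
      · simp only [Finset.mem_insert, Finset.mem_singleton, not_or] at hw
        by_cases h : ∃ i, l i = w
        · obtain ⟨i, rfl⟩ := h
          have h1 : i ≠ j := fun h => hw.2.1 (by rw [h])
          have h2 : i ≠ j + 1 := fun h => hw.2.2 (by rw [h])
          rw [hGl, fanHat_cone hm i j ha hb, if_neg h1, if_neg h2]
          simp
        · push Not at h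
          exact hG0 _ _ hw.1 h
      · rw [Finset.sum_insert (by simp [(hlv _).symm]), Finset.sum_pair (hl.ne (hj1 j)), hGv, hGl,
          hGl, fanHat_cone hm _ j ha hb, fanHat_cone hm _ j ha hb, hDcone j a b ha hb]
        have : 1 + (a + b) ≠ 0 := by positivity
        simp only [hj1 j, (hj1 j).symm, if_true, if_false]
        field_simp
        ring
  -- the chart
  set F : (V → ℝ) → ℂ := fun x => ∑ i : ZMod m, ((x (l i) / x v : ℝ) : ℂ) * ZMod.toCircle i with hF
  have hFG : ∀ z, F (G z) = z := by
    intro z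
    have : F (G z) = ∑ i : ZMod m, (fanHat i z : ℂ) * ZMod.toCircle i := by
      refine Finset.sum_congr rfl fun i _ => ?_
      rw [hGv, hGl, div_div_div_cancel_right₀ (hDpos z).ne', div_one]
    rw [this]
    obtain ⟨j, a, b, ha, hb, rfl⟩ := exists_mem_fan_cone hm z
    simp [fanHat_cone hm _ j ha hb, add_mul, Finset.sum_add_distrib, ite_mul,
      apply_ite (fun x : ℝ => (x : ℂ))]
  have hGF : ∀ x ∈ geomRealization K, 0 < x v → G (F x) = x := by
    intro x hx hxv
    obtain ⟨j, hj0, hj⟩ := hsupp x hx hxv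
    have ha : 0 ≤ x (l j) / x v := div_nonneg (hx.1 _) hxv.le
    have hb : 0 ≤ x (l (j + 1)) / x v := div_nonneg (hx.1 _) hxv.le
    have hFx : F x = ((x (l j) / x v : ℝ) : ℂ) * ZMod.toCircle j +
        ((x (l (j + 1)) / x v : ℝ) : ℂ) * ZMod.toCircle (j + 1) := by
      refine hsumz (fun w => x w / x v) j (fun w h1 h2 h3 => ?_) _
      simp only [hj0 w h1 h2 h3, zero_div]
    have hDx : D (F x) = 1 / x v := by
      rw [hFx, hDcone j _ _ ha hb]
      field_simp
      linarith
    funext w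
    by_cases hwv : w = v
    · rw [hwv, hGv, hDx, one_div_one_div]
    · by_cases h : ∃ i, l i = w
      · obtain ⟨i, rfl⟩ := h
        rw [hGl, hDx, hFx, fanHat_cone hm i j ha hb]
        by_cases h1 : i = j
        · subst h1
          simp only [if_true, hj1 i, if_false]
          field_simp
          ring
        · by_cases h2 : i = j + 1
          · subst h2
            simp only [if_true, (hj1 j).symm, if_false]
            field_simp
            ring
          · rw [hj0 _ (hlv i) (hl.ne h1) (hl.ne h2)]
            simp [h1, h2]
      · push Not at h
        rw [hG0 _ _ hwv h, hj0 w hwv (h j).symm (h (j + 1)).symm]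
  have hGc : Continuous G := by
    refine continuous_pi fun w => Continuous.div ?_ hDc fun z => (hDpos z).ne'
    refine continuous_const.add (continuous_finsetSum _ fun i _ => ?_)
    split_ifs
    exacts [continuous_fanHat i, continuous_const]
  have hFc : ContinuousOn F {x | 0 < x v} := by
    refine continuousOn_finsetSum _ fun i _ => ContinuousOn.mul ?_ continuousOn_const
    refine Complex.continuous_ofReal.comp_continuousOn ?_
    exact ContinuousOn.div (continuous_apply _).continuousOn (continuous_apply _).continuousOn
      fun x hx => (ne_of_gt hx)
  exact ⟨{ toFun := fun x => F x.1
           invFun := fun z => ⟨G z, hGmem z⟩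
           source := {x | 0 < x.1 v}
           target := Set.univ
           map_source' := fun _ _ => Set.mem_univ _
           map_target' := fun z _ => by
             change 0 < G z v
             rw [hGv]
             exact one_div_pos.2 (hDpos z)
           left_inv' := fun x hx => Subtype.ext (hGF x.1 x.2 hx)
           right_inv' := fun z _ => hFG z
           open_source := isOpen_lt continuous_const
             ((continuous_apply v).comp continuous_subtype_val)
           open_target := isOpen_univ
           continuousOn_toFun := hFc.comp continuous_subtype_val.continuousOn fun x hx => hx
           continuousOn_invFun := (hGc.subtype_mk hGmem).continuousOn }, rfl⟩

/-- A complex all of whose vertex links are cycles of length at least four is a topological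
2-manifold: the open stars of its vertices cover the realization. -/
theorem nonempty_chartedSpace_of_links (hm : 4 ≤ m) (K : PreAbstractSimplicialComplex V)
    (l : V → ZMod m → V) (hl : ∀ v, Function.Injective (l v)) (hlv : ∀ v j, l v j ≠ v)
    (hK : ∀ v, ∀ s : Finset V, v ∈ s →
      (s ∈ K.faces ↔ ∃ j, s ⊆ {v, l v j, l v (j + 1)})) :
    Nonempty (ChartedSpace (EuclideanSpace ℝ (Fin 2)) (geomRealization K)) := by
  choose e he using fun v => exists_chart_openStar hm K v (l v) (hl v) (hlv v) (hK v)
  have hpos : ∀ x : geomRealization K, ∃ v, 0 < x.1 v := by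
    rintro ⟨x, hx0, s, hs, hsx, hsum⟩
    by_contra h
    push Not at h
    have : ∑ v ∈ s, x v ≤ 0 := Finset.sum_nonpos fun v _ => h v
    linarith
  choose p hp using hpos
  let φ : ℂ ≃ₜ EuclideanSpace ℝ (Fin 2) :=
    Complex.orthonormalBasisOneI.repr.toHomeomorph
  exact ⟨{ atlas := Set.range fun v => (e v).trans φ.toOpenPartialHomeomorph
           chartAt := fun x => (e (p x)).trans φ.toOpenPartialHomeomorph
           mem_chart_source := fun x => by
             simpa [he] using hp x
           chart_mem_atlas := fun x => Set.mem_range_self _ }⟩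

end Star

/-! ### Cyclic complexes from a cyclic rotation at one vertex -/

section Rotation

/-- A cyclic arrangement `c` of distinct nonzero elements of `ZMod n` that is to be the link of
the vertex `0` of a cyclic complex on `ZMod n`. The field `rot` is Heffter's rule `Δ*`: shifted by
`-c j`, the oriented triangle `0, c j, c (j + 1)` becomes `0, c (j + 1) - c j, -c j`, which must
again be one of the oriented triangles at `0`. -/
structure CyclicRotation (n m : ℕ) where
  /-- The `j`-th neighbour of `0`. -/
  c : ZMod m → ZMod n
  inj : Function.Injective c
  ne_zero : ∀ j, c j ≠ 0
  rot : ∀ j, ∃ i, c i = c (j + 1) - c j ∧ c (i + 1) = -c j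

namespace CyclicRotation

variable {n m : ℕ} (R : CyclicRotation n m)

/-- The complex whose facets are the translates of the triangles `{0, c j, c (j + 1)}`. -/
def complex : PreAbstractSimplicialComplex (ZMod n) :=
  cyclicComplex n {t | ∃ j, t = {0, R.c j, R.c (j + 1)}}

lemma mem_complex {s : Finset (ZMod n)} : s ∈ R.complex.faces ↔
    s.Nonempty ∧ ∃ v j, s ⊆ {v, v + R.c j, v + R.c (j + 1)} := by
  change (s.Nonempty ∧ ∃ t ∈ {t : Finset (ZMod n) | ∃ j, t = {0, R.c j, R.c (j + 1)}}, ∃ a : ZMod n,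
    s ⊆ t.image (fun v => v + a)) ↔ _
  refine and_congr_right fun _ => ⟨?_, ?_⟩
  · rintro ⟨_, ⟨j, rfl⟩, a, h⟩
    refine ⟨a, j, h.trans ?_⟩
    simp [Finset.image_insert, add_comm]
  · rintro ⟨v, j, h⟩
    refine ⟨_, ⟨j, rfl⟩, v, h.trans ?_⟩
    simp [Finset.image_insert, add_comm]

/-- The link of every vertex is the translated cycle `c`. -/
lemma mem_complex_of_mem {s : Finset (ZMod n)} {v : ZMod n} (hv : v ∈ s) : s ∈ R.complex.faces ↔
    ∃ j, s ⊆ {v, v + R.c j, v + R.c (j + 1)} := by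
  rw [mem_complex]
  refine ⟨?_, fun ⟨j, h⟩ => ⟨⟨v, hv⟩, v, j, h⟩⟩
  rintro ⟨-, a, j, h⟩
  obtain ⟨i, hi, hi'⟩ := R.rot j
  obtain ⟨i₂, hi₂, hi₂'⟩ := R.rot i
  have hva := h hv
  simp only [Finset.mem_insert, Finset.mem_singleton] at hva
  rcases hva with rfl | rfl | rfl
  · exact ⟨j, h⟩
  · refine ⟨i, h.trans ?_⟩
    rw [hi, hi', add_neg_cancel_right, show a + R.c j + (R.c (j + 1) - R.c j) = a + R.c (j + 1) by
      ring]
    intro x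
    simp only [Finset.mem_insert, Finset.mem_singleton]
    tauto
  · refine ⟨i₂, h.trans ?_⟩
    rw [hi₂, hi₂', hi, hi', show a + R.c (j + 1) + (-R.c j - (R.c (j + 1) - R.c j)) = a by ring,
      show a + R.c (j + 1) + -(R.c (j + 1) - R.c j) = a + R.c j by ring]
    intro x
    simp only [Finset.mem_insert, Finset.mem_singleton]
    tauto

lemma singleton_mem (v : ZMod n) : {v} ∈ R.complex.faces :=
  (R.mem_complex_of_mem (Finset.mem_singleton_self v)).2 ⟨0, by simp⟩

lemma pair_mem_iff {v w : ZMod n} (h : v ≠ w) :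
    {v, w} ∈ R.complex.faces ↔ ∃ j, R.c j = w - v := by
  rw [R.mem_complex_of_mem (Finset.mem_insert_self v _)]
  constructor
  · rintro ⟨j, hj⟩
    have := hj (show w ∈ _ by simp)
    simp only [Finset.mem_insert, Finset.mem_singleton, h.symm, false_or] at this
    rcases this with h | h
    exacts [⟨j, by rw [h]; ring⟩, ⟨j + 1, by rw [h]; ring⟩]
  · rintro ⟨j, hj⟩
    refine ⟨j, ?_⟩
    rw [hj]
    intro x
    simp only [Finset.mem_insert, Finset.mem_singleton]
    rintro (rfl | rfl)
    · simp
    · simp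

/-- The cyclic order `a → b → c → a` agrees with the rotation at `a`. -/
def orientation (a b d : ZMod n) : Prop := ∃ j, R.c j = b - a ∧ R.c (j + 1) = d - a

lemma orientation_rotate {a b d : ZMod n} (h : R.orientation a b d) : R.orientation b d a := by
  obtain ⟨j, h1, h2⟩ := h
  obtain ⟨i, h3, h4⟩ := R.rot j
  exact ⟨i, by rw [h3, h2, h1]; ring, by rw [h4, h1]; ring⟩

lemma orientation_ne (hm : 2 ≤ m) {a b d : ZMod n} (h : R.orientation a b d) :
    a ≠ b ∧ b ≠ d ∧ a ≠ d := by
  obtain ⟨j, h1, h2⟩ := h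
  have : Fact (1 < m) := ⟨by omega⟩
  refine ⟨?_, ?_, ?_⟩
  · rintro rfl
    exact R.ne_zero j (by rw [h1, sub_self])
  · rintro rfl
    exact one_ne_zero (left_eq_add.1 (R.inj (h1.trans h2.symm)))
  · rintro rfl
    exact R.ne_zero (j + 1) (by rw [h2, sub_self])

lemma orientation_mem {a b d : ZMod n} (h : R.orientation a b d) :
    {a, b, d} ∈ R.complex.faces := by
  obtain ⟨j, h1, h2⟩ := h
  rw [R.mem_complex_of_mem (Finset.mem_insert_self a _)]
  exact ⟨j, by rw [h1, h2]; simp⟩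

lemma orientation_or {a b d : ZMod n} (hab : a ≠ b) (hbd : b ≠ d) (had : a ≠ d)
    (h : {a, b, d} ∈ R.complex.faces) : R.orientation a b d ∨ R.orientation a d b := by
  rw [R.mem_complex_of_mem (Finset.mem_insert_self a _)] at h
  obtain ⟨j, hj⟩ := h
  have hb := hj (show b ∈ _ by simp)
  have hd := hj (show d ∈ _ by simp)
  simp only [Finset.mem_insert, Finset.mem_singleton, hab.symm, had.symm, false_or] at hb hd
  rcases hb with hb | hb <;> rcases hd with hd | hd
  · exact absurd (hb.trans hd.symm) hbd
  · exact Or.inl ⟨j, by rw [hb]; ring, by rw [hd]; ring⟩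
  · exact Or.inr ⟨j, by rw [hd]; ring, by rw [hb]; ring⟩
  · exact absurd (hb.trans hd.symm) hbd

/-- Both orders of one triangle would make `c j, c (j + 1), c j` consecutive, which is impossible in
a cycle of length at least three. -/
lemma isCoherentOrientation (hm : 3 ≤ m) : IsCoherentOrientation R.complex R.orientation where
  triangle a b d h := by
    obtain ⟨h1, h2, h3⟩ := R.orientation_ne (by omega) h
    exact ⟨h1, h2, h3, R.orientation_mem h⟩
  rotate a b d h := R.orientation_rotate h
  choice a b d hab hbd had h := by
    have hnot : ¬ (R.orientation a b d ∧ R.orientation a d b) := by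
      rintro ⟨⟨j, h1, h2⟩, ⟨i, h3, h4⟩⟩
      have e1 : i = j + 1 := R.inj (h3.trans h2.symm)
      have e2 : i + 1 = j := R.inj (h4.trans h1.symm)
      have e3 : ((2 : ℕ) : ZMod m) = 0 := by
        have : j + 1 + 1 = j := by rw [← e1, e2]
        push_cast
        linear_combination this
      rw [ZMod.natCast_eq_zero_iff] at e3
      have := Nat.le_of_dvd (by norm_num) e3
      omega
    have hiff : R.orientation b a d ↔ R.orientation a d b :=
      ⟨R.orientation_rotate, fun h => R.orientation_rotate (R.orientation_rotate h)⟩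
    rw [hiff]
    rcases R.orientation_or hab hbd had h with h | h
    · exact Or.inl ⟨h, fun h' => hnot ⟨h, h'⟩⟩
    · exact Or.inr ⟨h, fun h' => hnot ⟨h', h⟩⟩
  coherent a b d e h1 h2 := by
    obtain ⟨j, hj, hj'⟩ := h1
    obtain ⟨i, hi, hi'⟩ := h2
    obtain rfl : i = j := R.inj (hi.trans hj.symm)
    exact sub_left_injective (hj'.symm.trans hi')

lemma card_le_three {s : Finset (ZMod n)} (hs : s ∈ R.complex.faces) : s.card ≤ 3 := by
  obtain ⟨-, v, j, h⟩ := R.mem_complex.1 hs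
  exact (Finset.card_le_card h).trans Finset.card_le_three

/-! ### Counting faces -/

lemma vertexDegree_complex (v : ZMod n) : vertexDegree R.complex v = m := by
  have : {w : ZMod n | w ≠ v ∧ {v, w} ∈ R.complex.faces} = Set.range fun j => v + R.c j := by
    ext w
    simp only [Set.mem_ofPred_eq, Set.mem_range]
    constructor
    · rintro ⟨h1, h2⟩
      obtain ⟨j, hj⟩ := (R.pair_mem_iff h1.symm).1 h2
      exact ⟨j, by rw [hj]; ring⟩
    · rintro ⟨j, rfl⟩
      have h : v ≠ v + R.c j := fun h => R.ne_zero j (left_eq_add.1 h)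
      exact ⟨h.symm, (R.pair_mem_iff h).2 ⟨j, by ring⟩⟩
  rw [vertexDegree, this, ← Nat.card_coe_set_eq,
    Nat.card_range_of_injective fun i j h => R.inj (add_left_cancel h), Nat.card_zmod]

lemma faceCount_zero : faceCount R.complex 0 = n := by
  have : {s : Finset (ZMod n) | s ∈ R.complex.faces ∧ s.card = 0 + 1} =
      Set.range fun v : ZMod n => ({v} : Finset (ZMod n)) := by
    ext s
    simp only [Set.mem_ofPred_eq, Set.mem_range, zero_add, Finset.card_eq_one]
    constructor
    · rintro ⟨-, v, rfl⟩
      exact ⟨v, rfl⟩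
    · rintro ⟨v, rfl⟩
      exact ⟨R.singleton_mem v, v, rfl⟩
  rw [faceCount, this, ← Nat.card_coe_set_eq, Nat.card_range_of_injective
    Finset.singleton_injective, Nat.card_zmod]

lemma add_c_ne (p : ZMod n × ZMod m) : p.1 ≠ p.1 + R.c p.2 :=
  fun h => R.ne_zero p.2 (left_eq_add.1 h)

variable [NeZero n] [NeZero m]

/-- The directed edges `a → a + c j` are counted twice by the edges. -/
lemma two_mul_faceCount_one : 2 * faceCount R.complex 1 = n * m := by
  classical
  set E : Finset (Finset (ZMod n)) :=
    Finset.univ.filter fun s => s ∈ R.complex.faces ∧ s.card = 1 + 1 with hE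
  have hcount : faceCount R.complex 1 = E.card := by
    rw [faceCount, ← Set.ncard_coe_finset]
    congr 1
    ext s
    simp [hE]
  have h := Finset.card_eq_sum_card_fiberwise (s := (Finset.univ : Finset (ZMod n × ZMod m)))
    (t := E) (f := fun p => {p.1, p.1 + R.c p.2}) (by
      intro p _
      simp only [hE, Finset.coe_filter, Finset.mem_univ, true_and, Set.mem_ofPred_eq]
      exact ⟨(R.pair_mem_iff (R.add_c_ne p)).2 ⟨p.2, by ring⟩, Finset.card_pair (R.add_c_ne p)⟩)
  rw [Finset.card_univ, Fintype.card_prod, ZMod.card, ZMod.card] at h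
  rw [h, hcount, mul_comm, ← smul_eq_mul, ← Finset.sum_const]
  refine Finset.sum_congr rfl fun s hs => ?_
  simp only [hE, Finset.mem_filter, Finset.mem_univ, true_and] at hs
  obtain ⟨hs, hcard⟩ := hs
  obtain ⟨a, b, hab, rfl⟩ := Finset.card_eq_two.1 hcard
  obtain ⟨i, hi⟩ := (R.pair_mem_iff hab).1 hs
  obtain ⟨j, hj⟩ := (R.pair_mem_iff hab.symm).1 (by rwa [Finset.pair_comm])
  have : Finset.univ.filter (fun p : ZMod n × ZMod m => ({p.1, p.1 + R.c p.2} : Finset _) = {a, b})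
      = {(a, i), (b, j)} := by
    ext ⟨u, t⟩
    simp only [Finset.mem_filter, Finset.mem_univ, true_and, Finset.mem_insert,
      Finset.mem_singleton, Prod.mk.injEq]
    constructor
    · intro h
      have hne := R.add_c_ne (u, t)
      have hu : u ∈ ({a, b} : Finset _) := h ▸ by simp
      have hv : u + R.c t ∈ ({a, b} : Finset _) := h ▸ by simp
      simp only [Finset.mem_insert, Finset.mem_singleton] at hu hv hne
      rcases hu with rfl | rfl
      · refine Or.inl ⟨rfl, R.inj ?_⟩
        rw [hi]
        rcases hv with hv | hv
        · exact absurd hv.symm hne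
        · rw [← hv]; ring
      · refine Or.inr ⟨rfl, R.inj ?_⟩
        rw [hj]
        rcases hv with hv | hv
        · rw [← hv]; ring
        · exact absurd hv.symm hne
    · rintro (⟨rfl, rfl⟩ | ⟨rfl, rfl⟩)
      · rw [hi]; simp
      · rw [hj, Finset.pair_comm]; simp
  rw [this, Finset.card_pair]
  simp [hab]

/-- The oriented triangles with a distinguished vertex are counted three times by the triangles. -/
lemma three_mul_faceCount_two (hm : 3 ≤ m) : 3 * faceCount R.complex 2 = n * m := by
  classical
  set E : Finset (Finset (ZMod n)) :=
    Finset.univ.filter fun s => s ∈ R.complex.faces ∧ s.card = 2 + 1 with hE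
  have hcount : faceCount R.complex 2 = E.card := by
    rw [faceCount, ← Set.ncard_coe_finset]
    congr 1
    ext s
    simp [hE]
  have hor : ∀ p : ZMod n × ZMod m,
      R.orientation p.1 (p.1 + R.c p.2) (p.1 + R.c (p.2 + 1)) := fun p => ⟨p.2, by simp, by simp⟩
  have hO := R.isCoherentOrientation hm
  have h := Finset.card_eq_sum_card_fiberwise (s := (Finset.univ : Finset (ZMod n × ZMod m)))
    (t := E) (f := fun p => {p.1, p.1 + R.c p.2, p.1 + R.c (p.2 + 1)}) (by
      intro p _
      simp only [hE, Finset.coe_filter, Finset.mem_univ, true_and, Set.mem_ofPred_eq]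
      obtain ⟨h1, h2, h3, h4⟩ := hO.triangle _ _ _ (hor p)
      exact ⟨h4, Finset.card_eq_three.2 ⟨_, _, _, h1, h3, h2, rfl⟩⟩)
  rw [Finset.card_univ, Fintype.card_prod, ZMod.card, ZMod.card] at h
  rw [h, hcount, mul_comm, ← smul_eq_mul, ← Finset.sum_const]
  refine Finset.sum_congr rfl fun s hs => ?_
  simp only [hE, Finset.mem_filter, Finset.mem_univ, true_and] at hs
  obtain ⟨hs, hcard⟩ := hs
  -- The vertices of the triangle are named in the order given by the orientation.
  obtain ⟨a, b, d, rfl, habd⟩ : ∃ a b d, s = {a, b, d} ∧ R.orientation a b d := by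
    obtain ⟨a, b, d, hab, had, hbd, rfl⟩ := Finset.card_eq_three.1 hcard
    rcases R.orientation_or hab hbd had hs with h | h
    · exact ⟨a, b, d, rfl, h⟩
    · exact ⟨a, d, b, by rw [Finset.pair_comm], h⟩
  obtain ⟨hab, hbd, had⟩ := R.orientation_ne (by omega) habd
  obtain ⟨i₁, hi₁, hi₁'⟩ := habd
  obtain ⟨i₂, hi₂, hi₂'⟩ := R.orientation_rotate ⟨i₁, hi₁, hi₁'⟩
  obtain ⟨i₃, hi₃, hi₃'⟩ := R.orientation_rotate ⟨i₂, hi₂, hi₂'⟩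
  have : Finset.univ.filter (fun p : ZMod n × ZMod m =>
      ({p.1, p.1 + R.c p.2, p.1 + R.c (p.2 + 1)} : Finset _) = {a, b, d})
      = {(a, i₁), (b, i₂), (d, i₃)} := by
    ext ⟨u, t⟩
    simp only [Finset.mem_filter, Finset.mem_univ, true_and, Finset.mem_insert,
      Finset.mem_singleton, Prod.mk.injEq]
    constructor
    · intro h
      -- only one of the two cyclic orders of `{a, b, d}` belongs to the orientation
      have hex : ∀ {x y z j}, R.c j = y - x → R.c (j + 1) = z - x →
          R.c t = z - x → R.c (t + 1) = y - x → False := by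
        intro x y z j h1 h2 h3 h4
        have hxyz : R.orientation x y z := ⟨j, h1, h2⟩
        have hxzy : R.orientation x z y := ⟨t, h3, h4⟩
        obtain ⟨n1, n2, n3, n4⟩ := hO.triangle _ _ _ hxyz
        rcases hO.choice x y z n1 n2 n3 n4 with h | h
        · exact h.2 (R.orientation_rotate (R.orientation_rotate hxzy))
        · exact h.2 hxyz
      have huv := hor (u, t)
      obtain ⟨n1, n2, n3⟩ := R.orientation_ne (by omega) huv
      have hu : u ∈ ({a, b, d} : Finset _) := h ▸ by simp
      have hv : u + R.c t ∈ ({a, b, d} : Finset _) := h ▸ by simp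
      have hw : u + R.c (t + 1) ∈ ({a, b, d} : Finset _) := h ▸ by simp
      simp only [Finset.mem_insert, Finset.mem_singleton] at hu hv hw n1 n2 n3
      have key : ∀ {x y z j}, R.c j = y - x → R.c (j + 1) = z - x → u = x →
          (u + R.c t = x ∨ u + R.c t = y ∨ u + R.c t = z) →
          (u + R.c (t + 1) = x ∨ u + R.c (t + 1) = y ∨ u + R.c (t + 1) = z) → t = j := by
        rintro x y z j h1 h2 rfl (e | e | e) he
        · exact absurd e.symm n1
        · exact R.inj (by rw [h1, ← e]; ring)
        · rcases he with e' | e' | e'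
          · exact absurd e'.symm n3
          · exact (hex h1 h2 (by rw [← e]; ring) (by rw [← e']; ring)).elim
          · exact absurd (e.trans e'.symm) n2
      rcases hu with hu | hu | hu
      · exact Or.inl ⟨hu, key hi₁ hi₁' hu (by tauto) (by tauto)⟩
      · exact Or.inr (Or.inl ⟨hu, key hi₂ hi₂' hu (by tauto) (by tauto)⟩)
      · exact Or.inr (Or.inr ⟨hu, key hi₃ hi₃' hu (by tauto) (by tauto)⟩)
    · rintro (⟨rfl, rfl⟩ | ⟨rfl, rfl⟩ | ⟨rfl, rfl⟩)
      · rw [hi₁, hi₁']; simp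
      · rw [hi₂, hi₂']
        ext x
        simp only [add_sub_cancel, Finset.mem_insert, Finset.mem_singleton]
        tauto
      · rw [hi₃, hi₃']
        ext x
        simp only [add_sub_cancel, Finset.mem_insert, Finset.mem_singleton]
        tauto
  rw [this, Finset.card_eq_three.2 ⟨_, _, _, ?_, ?_, ?_, rfl⟩]
  · simp [hab]
  · simp [had]
  · simp [hbd]

end CyclicRotation

/-! ### Compactness and connectedness of the realization -/

/-- The closed simplex spanned by a set of vertices, in barycentric coordinates. -/
def barycentricSimplex {V : Type*} (s : Finset V) : Set (V → ℝ) :=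
  {x | (∀ v, 0 ≤ x v) ∧ (∀ v, v ∉ s → x v = 0) ∧ ∑ v ∈ s, x v = 1}

lemma convex_barycentricSimplex {V : Type*} (s : Finset V) : Convex ℝ (barycentricSimplex s) := by
  rintro x ⟨hx, hxs, hx1⟩ y ⟨hy, hys, hy1⟩ a b ha hb hab
  refine ⟨fun v => ?_, fun v hv => ?_, ?_⟩
  · have := hx v
    have := hy v
    simp only [Pi.add_apply, Pi.smul_apply, smul_eq_mul]
    positivity
  · simp [hxs v hv, hys v hv]
  · simp [Finset.sum_add_distrib, ← Finset.mul_sum, hx1, hy1, hab]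

lemma isCompact_barycentricSimplex {V : Type*} (s : Finset V) :
    IsCompact (barycentricSimplex s) := by
  refine (isCompact_univ_pi fun _ : V => isCompact_Icc (a := (0 : ℝ)) (b := 1)).of_isClosed_subset
    ?_ ?_
  · refine IsClosed.and ?_ (IsClosed.and ?_ ?_)
    · simp only [Set.ofPred_forall]
      exact isClosed_iInter fun v => isClosed_le continuous_const (continuous_apply v)
    · simp only [Set.ofPred_forall]
      exact isClosed_iInter fun v => isClosed_iInter fun _ =>
        isClosed_eq (continuous_apply v) continuous_const
    · exact isClosed_eq (by fun_prop) continuous_const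
  · rintro x ⟨hx, hxs, hx1⟩ v -
    refine ⟨hx v, ?_⟩
    by_cases hv : v ∈ s
    · rw [← hx1]
      exact Finset.single_le_sum (fun w _ => hx w) hv
    · rw [hxs v hv]
      exact zero_le_one

lemma geomRealization_eq_iUnion {V : Type*} (K : PreAbstractSimplicialComplex V) :
    geomRealization K = ⋃ s ∈ K.faces, barycentricSimplex s := by
  ext x
  simp only [geomRealization, barycentricSimplex, Set.mem_ofPred_eq, Set.mem_iUnion, exists_prop]
  tauto

lemma single_mem_barycentricSimplex {V : Type*} [DecidableEq V] {s : Finset V} {v : V}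
    (hv : v ∈ s) : (Pi.single v 1 : V → ℝ) ∈ barycentricSimplex s := by
  refine ⟨fun w => ?_, fun w hw => ?_, ?_⟩
  · by_cases h : w = v
    · subst h; simp
    · simp [h]
  · exact Pi.single_eq_of_ne (by rintro rfl; exact hw hv) _
  · simp [Pi.single_apply, hv]

lemma compactSpace_geomRealization {V : Type*} {K : PreAbstractSimplicialComplex V}
    (hK : K.faces.Finite) : CompactSpace (geomRealization K) := by
  rw [← isCompact_iff_compactSpace, geomRealization_eq_iUnion]
  exact hK.isCompact_biUnion fun s _ => isCompact_barycentricSimplex s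

/-- The realization is connected if the vertices are connected by paths of edges: the simplices
at a vertex form a connected set, and the sets of two adjacent vertices meet. -/
lemma connectedSpace_geomRealization {V : Type*} [DecidableEq V] [Nonempty V]
    {K : PreAbstractSimplicialComplex V} (h1 : ∀ v, {v} ∈ K.faces)
    (h2 : ∀ v w, Relation.ReflTransGen (fun v w => {v, w} ∈ K.faces) v w) :
    ConnectedSpace (geomRealization K) := by
  rw [← isConnected_iff_connectedSpace]
  set A : V → Set (V → ℝ) := fun v => ⋃ s ∈ {s ∈ K.faces | v ∈ s}, barycentricSimplex s with hA
  have hsub : ∀ v, A v ⊆ geomRealization K := by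
    intro v
    rw [geomRealization_eq_iUnion]
    exact Set.biUnion_subset_biUnion_left fun s hs => hs.1
  have hmem : ∀ {v s}, s ∈ K.faces → v ∈ s → barycentricSimplex s ⊆ A v := by
    intro v s hs hv
    exact Set.subset_biUnion_of_mem (u := barycentricSimplex) (show s ∈ {s ∈ K.faces | v ∈ s} from
      ⟨hs, hv⟩)
  have hunion : geomRealization K = ⋃ v, A v := by
    refine Set.Subset.antisymm ?_ (Set.iUnion_subset hsub)
    rw [geomRealization_eq_iUnion]
    refine Set.iUnion₂_subset fun s hs => ?_
    obtain ⟨v, hv⟩ := (K.isRelLowerSet_faces hs).1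
    exact (hmem hs hv).trans (Set.subset_iUnion A v)
  have hpre : ∀ v, IsPreconnected (A v) := by
    intro v
    refine isPreconnected_of_forall (Pi.single v 1) fun y hy => ?_
    simp only [hA, Set.mem_iUnion] at hy
    obtain ⟨s, hs, hy⟩ := hy
    exact ⟨_, hmem hs.1 hs.2, single_mem_barycentricSimplex hs.2, hy,
      (convex_barycentricSimplex s).isPreconnected⟩
  rw [hunion]
  refine IsConnected.iUnion_of_reflTransGen (fun v => ⟨⟨Pi.single v 1, hmem (h1 v) (by simp)
    (single_mem_barycentricSimplex (by simp))⟩, hpre v⟩) fun v w => ?_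
  refine Relation.ReflTransGen.mono (fun a b hab => ⟨Pi.single a 1, hmem hab (by simp)
    (single_mem_barycentricSimplex (by simp)), hmem hab (by simp)
    (single_mem_barycentricSimplex (by simp))⟩) _ _ (h2 v w)

namespace CyclicRotation

variable {n m : ℕ} (R : CyclicRotation n m) [NeZero n] [NeZero m]

/-- The Euler characteristic is `n - nm/2 + nm/3 = n (6 - m) / 6`. -/
theorem triangulates (hm : 4 ≤ m) (h1 : ∃ j, R.c j = 1) (g : ℕ)
    (hg : n * m + 12 = 6 * n + 12 * g) : TriangulatesOrientableSurface R.complex g where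
  finite := Set.toFinite _
  dim_le_two _ hs := R.card_le_three hs
  compact := compactSpace_geomRealization (Set.toFinite _)
  hausdorff := inferInstance
  connected := by
    refine connectedSpace_geomRealization R.singleton_mem ?_
    have hstep : ∀ v : ZMod n, {v, v + 1} ∈ R.complex.faces := by
      intro v
      by_cases h : v = v + 1
      · rw [← h]
        simpa using R.singleton_mem v
      · exact (R.pair_mem_iff h).2 (by simpa using h1)
    have : ∀ (v : ZMod n) (d : ℕ),
        Relation.ReflTransGen (fun v w => {v, w} ∈ R.complex.faces) v (v + d) := by
      intro v d
      induction d with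
      | zero => simpa using Relation.ReflTransGen.refl
      | succ d ih =>
        refine ih.tail ?_
        rw [Nat.cast_succ, ← add_assoc]
        exact hstep _
    intro v w
    simpa using this v (w - v).val
  manifold := nonempty_chartedSpace_of_links hm R.complex (fun v j => v + R.c j)
    (fun v i j h => R.inj (add_left_cancel h)) (fun v j h => R.ne_zero j (add_eq_left.1 h))
    fun v s hs => R.mem_complex_of_mem hs
  orientable := ⟨_, R.isCoherentOrientation (by omega)⟩
  euler := by
    have e1 := R.two_mul_faceCount_one
    have e2 := R.three_mul_faceCount_two (by omega)
    rw [eulerCharTwo, R.faceCount_zero]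
    omega

end CyclicRotation

end Rotation

/-! ### The walk in Ringel's current graph -/

section Walk

/-- The position, between `1` and `12k+6`, of a current in the closed walk through the arcs of
Ringel's current graph; the walk is cut open so that it ends with the arc `5k+3` traversed
backwards. The value matters for the currents `±1, …, ±(6k+3)` only. -/
def ringelIndex (k : ℕ) (a : ℤ) : ℤ :=
  if 0 < a then
    if a ≤ 2 * k then 12 * k + 7 - 2 * a
    else if a = 2 * k + 1 then 2 * k + 2
    else if a ≤ 3 * k + 2 then 4 * a - 4 * k - 4
    else if a ≤ 4 * k + 2 then 24 * k + 16 - 4 * a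
    else if a ≤ 5 * k + 3 then 12 * k + 9 - 2 * a
    else 2 * a - 8 * k - 4
  else
    if -a ≤ 2 * k then 8 * k + 5 + 2 * a
    else if -a = 2 * k + 1 then 8 * k + 5
    else if -a ≤ 3 * k + 2 then 6 * k + 5 + 2 * a
    else if -a ≤ 4 * k + 2 then -2 * a - 6 * k - 4
    else if -a ≤ 5 * k + 3 then -4 * a - 8 * k - 6
    else 28 * k + 18 + 4 * a

variable {k : ℕ} {a : ℤ}

lemma ringelIndex_pos_low (h₁ : 0 < a) (h₂ : a ≤ 2 * k) :
    ringelIndex k a = 12 * k + 7 - 2 * a := by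
  rw [ringelIndex, if_pos (by omega), if_pos (by omega)]

lemma ringelIndex_pos_rung (h₁ : 2 * k + 1 ≤ a) (h₂ : a ≤ 2 * k + 1) :
    ringelIndex k a = 2 * k + 2 := by
  rw [ringelIndex, if_pos (by omega), if_neg (by omega), if_pos (by omega)]

lemma ringelIndex_pos_three (h₁ : 2 * k + 2 ≤ a) (h₂ : a ≤ 3 * k + 2) :
    ringelIndex k a = 4 * a - 4 * k - 4 := by
  rw [ringelIndex, if_pos (by omega), if_neg (by omega), if_neg (by omega), if_pos (by omega)]

lemma ringelIndex_pos_four (h₁ : 3 * k + 3 ≤ a) (h₂ : a ≤ 4 * k + 2) :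
    ringelIndex k a = 24 * k + 16 - 4 * a := by
  rw [ringelIndex, if_pos (by omega), if_neg (by omega), if_neg (by omega),
    if_neg (by omega), if_pos (by omega)]

lemma ringelIndex_pos_five (h₁ : 4 * k + 3 ≤ a) (h₂ : a ≤ 5 * k + 3) :
    ringelIndex k a = 12 * k + 9 - 2 * a := by
  rw [ringelIndex, if_pos (by omega), if_neg (by omega), if_neg (by omega), if_neg (by omega),
    if_neg (by omega), if_pos (by omega)]

lemma ringelIndex_pos_six (h₁ : 5 * k + 4 ≤ a) (h₂ : a ≤ 6 * k + 3) :
    ringelIndex k a = 2 * a - 8 * k - 4 := by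
  rw [ringelIndex, if_pos (by omega), if_neg (by omega), if_neg (by omega),
    if_neg (by omega), if_neg (by omega), if_neg (by omega)]

lemma ringelIndex_neg_low (h₁ : a < 0) (h₂ : -a ≤ 2 * k) :
    ringelIndex k a = 8 * k + 5 + 2 * a := by
  rw [ringelIndex, if_neg (by omega), if_pos (by omega)]

lemma ringelIndex_neg_rung (h₁ : 2 * k + 1 ≤ -a) (h₂ : -a ≤ 2 * k + 1) :
    ringelIndex k a = 8 * k + 5 := by
  rw [ringelIndex, if_neg (by omega), if_neg (by omega), if_pos (by omega)]

lemma ringelIndex_neg_three (h₁ : 2 * k + 2 ≤ -a) (h₂ : -a ≤ 3 * k + 2) :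
    ringelIndex k a = 6 * k + 5 + 2 * a := by
  rw [ringelIndex, if_neg (by omega), if_neg (by omega),
    if_neg (by omega), if_pos (by omega)]

lemma ringelIndex_neg_four (h₁ : 3 * k + 3 ≤ -a) (h₂ : -a ≤ 4 * k + 2) :
    ringelIndex k a = -2 * a - 6 * k - 4 := by
  rw [ringelIndex, if_neg (by omega), if_neg (by omega), if_neg (by omega),
    if_neg (by omega), if_pos (by omega)]

lemma ringelIndex_neg_five (h₁ : 4 * k + 3 ≤ -a) (h₂ : -a ≤ 5 * k + 3) :
    ringelIndex k a = -4 * a - 8 * k - 6 := by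
  rw [ringelIndex, if_neg (by omega), if_neg (by omega), if_neg (by omega), if_neg (by omega),
    if_neg (by omega), if_pos (by omega)]

lemma ringelIndex_neg_six (h₁ : 5 * k + 4 ≤ -a) (h₂ : -a ≤ 6 * k + 3) :
    ringelIndex k a = 28 * k + 18 + 4 * a := by
  rw [ringelIndex, if_neg (by omega), if_neg (by omega), if_neg (by omega),
    if_neg (by omega), if_neg (by omega), if_neg (by omega)]

/-- The position advances by one along every step of the walk, modulo the total length `12k+6`. -/
lemma RingelStep.ringelIndex_eq {k : ℕ} {a b : ℤ} (h : RingelStep k a b) :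
    ringelIndex k b = ringelIndex k a + 1 ∨
      ringelIndex k b = ringelIndex k a + 1 - (6 + 12 * k) := by
  have key : ∀ x y z, RingelNode k x y z → (a = -x ∧ b = y ∨ a = -y ∧ b = z ∨ a = -z ∧ b = x) →
      ringelIndex k b = ringelIndex k a + 1 ∨
        ringelIndex k b = ringelIndex k a + 1 - (6 + 12 * k) := by
    intro x y z hn hab
    cases hn with
    | v_odd i hi =>
      rcases hab with ⟨rfl, rfl⟩ | ⟨rfl, rfl⟩ | ⟨rfl, rfl⟩
      · rw [ringelIndex_neg_four (by omega) (by omega),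
          ringelIndex_neg_three (by omega) (by omega)]
        omega
      · rw [ringelIndex_pos_low (by omega) (by omega),
          ringelIndex_pos_four (by omega) (by omega)]
        omega
      · rw [ringelIndex_pos_three (by omega) (by omega),
          ringelIndex_neg_low (by omega) (by omega)]
        omega
    | v_even i hi =>
      rcases hab with ⟨rfl, rfl⟩ | ⟨rfl, rfl⟩ | ⟨rfl, rfl⟩
      · rw [ringelIndex_neg_three (by omega) (by omega),
          ringelIndex_neg_four (by omega) (by omega)]
        omega
      · rw [ringelIndex_neg_low (by omega) (by omega),
          ringelIndex_pos_three (by omega) (by omega)]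
        omega
      · rw [ringelIndex_pos_four (by omega) (by omega),
          ringelIndex_pos_low (by omega) (by omega)]
        omega
    | w_odd i hi =>
      rcases hab with ⟨rfl, rfl⟩ | ⟨rfl, rfl⟩ | ⟨rfl, rfl⟩
      · rw [ringelIndex_neg_low (by omega) (by omega),
          ringelIndex_neg_six (by omega) (by omega)]
        omega
      · rw [ringelIndex_neg_five (by omega) (by omega),
          ringelIndex_pos_low (by omega) (by omega)]
        omega
      · rw [ringelIndex_pos_six (by omega) (by omega),
          ringelIndex_pos_five (by omega) (by omega)]
        omega
    | w_even i hi =>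
      rcases hab with ⟨rfl, rfl⟩ | ⟨rfl, rfl⟩ | ⟨rfl, rfl⟩
      · rw [ringelIndex_pos_low (by omega) (by omega),
          ringelIndex_neg_five (by omega) (by omega)]
        omega
      · rw [ringelIndex_neg_six (by omega) (by omega),
          ringelIndex_neg_low (by omega) (by omega)]
        omega
      · rw [ringelIndex_pos_five (by omega) (by omega),
          ringelIndex_pos_six (by omega) (by omega)]
        omega
    | leftEnd =>
      rcases hab with ⟨rfl, rfl⟩ | ⟨rfl, rfl⟩ | ⟨rfl, rfl⟩
      · rw [ringelIndex_pos_rung (by omega) (by omega),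
          ringelIndex_neg_three (by omega) (by omega)]
        omega
      · rw [ringelIndex_neg_five (by omega) (by omega),
          ringelIndex_neg_rung (by omega) (by omega)]
        omega
      · rw [ringelIndex_pos_three (by omega) (by omega),
          ringelIndex_pos_five (by omega) (by omega)]
        omega
    | rightEnd =>
      rcases hab with ⟨rfl, rfl⟩ | ⟨rfl, rfl⟩ | ⟨rfl, rfl⟩
      · rw [ringelIndex_neg_three (by omega) (by omega),
          ringelIndex_neg_five (by omega) (by omega)]
        omega
      · rw [ringelIndex_neg_rung (by omega) (by omega),
          ringelIndex_pos_three (by omega) (by omega)]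
        omega
      · rw [ringelIndex_pos_five (by omega) (by omega),
          ringelIndex_pos_rung (by omega) (by omega)]
        omega
  obtain ⟨z, h | h | h⟩ := h
  · exact key _ _ _ h (by simp)
  · exact key _ _ _ h (by simp)
  · exact key _ _ _ h (by simp)

lemma RingelNode.sum_eq_zero {k : ℕ} {x y z : ℤ} (h : RingelNode k x y z) : x + y + z = 0 := by
  cases h <;> ring

/-- Kirchhoff's law at the vertices of the current graph yields Heffter's rule for the walk. -/
lemma RingelStep.rotate {k : ℕ} {a b : ℤ} (h : RingelStep k a b) : RingelStep k (b - a) (-a) := by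
  obtain ⟨z, h⟩ := h
  -- The step from `a` to `b` passes a vertex with outgoing currents `-a, b, z`, and `z = a - b`.
  have hz : -(b - a) = z := by
    rcases h with h | h | h <;> have := h.sum_eq_zero <;> linarith
  refine ⟨b, ?_⟩
  rw [hz]
  tauto

/-- Every current is followed by another one. -/
lemma exists_ringelStep {k : ℕ} {a : ℤ} (h0 : a ≠ 0) (h1 : -(6 * k + 3) ≤ a)
    (h2 : a ≤ 6 * k + 3) : ∃ b, RingelStep k a b := by
  -- `e` is the outgoing current, at the vertex reached, of the arc with current `a`
  suffices ∀ e : ℤ, -a = e → ∃ x y z, RingelNode k x y z ∧ (e = x ∨ e = y ∨ e = z) by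
    obtain ⟨x, y, z, hn, h⟩ := this _ rfl
    rcases h with h | h | h
    · exact ⟨y, z, Or.inl (h ▸ hn)⟩
    · exact ⟨z, x, Or.inr (Or.inr (h ▸ hn))⟩
    · exact ⟨x, y, Or.inr (Or.inl (h ▸ hn))⟩
  intro e he
  by_cases hL : e = 2 * k + 2 ∨ e = 2 * k + 1 ∨ e = -(4 * k + 3)
  · exact ⟨_, _, _, .leftEnd, hL⟩
  by_cases hR : e = 5 * k + 3 ∨ e = -(3 * k + 2) ∨ e = -(2 * k + 1)
  · exact ⟨_, _, _, .rightEnd, hR⟩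
  have hv : ∃ i : ℕ, i < k ∧
      ((e = 3 * k + 2 - i ∨ e = -(3 * k + 3 + i) ∨ e = 2 * i + 1) ∨
      (e = 3 * k + 3 + i ∨ e = -(3 * k + 1 - i) ∨ e = -(2 * i + 2)) ∨
      (e = 5 * k + 4 + i ∨ e = -(2 * i + 1) ∨ e = -(5 * k + 3 - i)) ∨
      (e = 5 * k + 2 - i ∨ e = 2 * i + 2 ∨ e = -(5 * k + 4 + i))) := by
    -- the index of the rung at whose end `e` leaves
    refine ⟨(if 0 < e then
      if e ≤ 2 * k then (e - 1) / 2 else if e ≤ 3 * k + 2 then 3 * k + 2 - e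
      else if e ≤ 4 * k + 2 then e - (3 * k + 3) else if e ≤ 5 * k + 2 then 5 * k + 2 - e
      else e - (5 * k + 4)
    else if -e ≤ 2 * k then (-e - 1) / 2 else if -e ≤ 3 * k + 1 then 3 * k + 1 + e
      else if -e ≤ 4 * k + 2 then -e - (3 * k + 3) else if -e ≤ 5 * k + 3 then 5 * k + 3 + e
      else -e - (5 * k + 4)).toNat, ?_, ?_⟩
    · split_ifs <;> omega
    · split_ifs <;> omega
  obtain ⟨i, hi, h | h | h | h⟩ := hv
  · exact ⟨_, _, _, .v_odd i hi, h⟩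
  · exact ⟨_, _, _, .v_even i hi, h⟩
  · exact ⟨_, _, _, .w_odd i hi, h⟩
  · exact ⟨_, _, _, .w_even i hi, h⟩

/-! ### The generating triangles and the vertices of the current graph -/

/-- Each vertex of the current graph corresponds to the orbit of one generating triangle. The
vertices of the `w`-side are matched in reverse order. -/
lemma RingelNode.exists_generatingTriangle {k : ℕ} {x y z : ℤ} (h : RingelNode k x y z) :
    ∃ u ∈ generatingTriangles k, ∃ a : ℤ,
      u.image (fun p : ℕ => (p : ℤ)) = {a, -x + a, y + a} := by
  have tri : ∀ p q : ℕ, ({0, p, q} : Finset ℕ).image (fun p : ℕ => (p : ℤ)) =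
      {0, (p : ℤ), (q : ℤ)} := by
    intro p q
    simp [Finset.image_insert]
  simp only [generatingTriangles, Finset.mem_union, Finset.mem_image, Finset.mem_range,
    Finset.mem_insert, Finset.mem_singleton]
  cases h with
  | v_odd i hi =>
    refine ⟨_, Or.inl (Or.inl (Or.inl (Or.inl ⟨i, hi, rfl⟩))), 3 * k + 3 + i, ?_⟩
    rw [tri]; ext w; simp only [Finset.mem_insert, Finset.mem_singleton]; omega
  | v_even i hi =>
    refine ⟨_, Or.inl (Or.inl (Or.inl (Or.inr ⟨i, hi, rfl⟩))), 3 * k + 3 + i, ?_⟩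
    rw [tri]; ext w; simp only [Finset.mem_insert, Finset.mem_singleton]; omega
  | w_odd i hi =>
    refine ⟨_, Or.inl (Or.inr ⟨k - 1 - i, by omega, rfl⟩), 5 * k + 4 + i, ?_⟩
    rw [tri]; ext w; simp only [Finset.mem_insert, Finset.mem_singleton]; omega
  | w_even i hi =>
    refine ⟨_, Or.inl (Or.inl (Or.inr ⟨k - 1 - i, by omega, rfl⟩)), 5 * k + 2 - i, ?_⟩
    rw [tri]; ext w; simp only [Finset.mem_insert, Finset.mem_singleton]; omega
  | leftEnd =>
    refine ⟨_, Or.inr (Or.inl rfl), 2 * k + 2, ?_⟩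
    rw [tri]; ext w; simp only [Finset.mem_insert, Finset.mem_singleton]; omega
  | rightEnd =>
    refine ⟨_, Or.inr (Or.inr rfl), 5 * k + 3, ?_⟩
    rw [tri]; ext w; simp only [Finset.mem_insert, Finset.mem_singleton]; omega

/-- The three steps through a vertex of the current graph yield translates of one triangle. -/
lemma RingelStep.exists_generatingTriangle {k : ℕ} {a b : ℤ} (h : RingelStep k a b) :
    ∃ u ∈ generatingTriangles k, ∃ d : ℤ,
      u.image (fun p : ℕ => (p : ℤ)) = {d, a + d, b + d} := by
  obtain ⟨z, h | h | h⟩ := h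
  · simpa using h.exists_generatingTriangle
  · obtain ⟨u, hu, d, hd⟩ := h.exists_generatingTriangle
    have := h.sum_eq_zero
    refine ⟨u, hu, d - b, ?_⟩
    rw [hd]; ext w; simp only [Finset.mem_insert, Finset.mem_singleton]; omega
  · obtain ⟨u, hu, d, hd⟩ := h.exists_generatingTriangle
    have := h.sum_eq_zero
    refine ⟨u, hu, d - a, ?_⟩
    rw [hd]; ext w; simp only [Finset.mem_insert, Finset.mem_singleton]; omega

lemma exists_ringelStep_of_mem_generatingTriangles {k : ℕ} {u : Finset ℕ}
    (hu : u ∈ generatingTriangles k) : ∃ a b d : ℤ, RingelStep k a b ∧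
      u.image (fun p : ℕ => (p : ℤ)) = {d, a + d, b + d} := by
  have step : ∀ {x y z : ℤ}, RingelNode k x y z → RingelStep k (-x) y :=
    fun {x y z} h => ⟨z, Or.inl (by rwa [neg_neg])⟩
  simp only [generatingTriangles, Finset.mem_union, Finset.mem_image, Finset.mem_range,
    Finset.mem_insert, Finset.mem_singleton] at hu
  rcases hu with (((⟨i, hi, rfl⟩ | ⟨i, hi, rfl⟩) | ⟨i, hi, rfl⟩) | ⟨i, hi, rfl⟩) | rfl | rfl
  · refine ⟨_, _, 3 * k + 3 + i, step (.v_odd i hi), ?_⟩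
    ext w
    simp only [Finset.image_insert, Finset.image_singleton, Finset.mem_insert,
      Finset.mem_singleton]
    omega
  · refine ⟨_, _, 3 * k + 3 + i, step (.v_even i hi), ?_⟩
    ext w
    simp only [Finset.image_insert, Finset.image_singleton, Finset.mem_insert,
      Finset.mem_singleton]
    omega
  · refine ⟨_, _, 4 * k + 3 + i, step (.w_even (k - 1 - i) (by omega)), ?_⟩
    ext w
    simp only [Finset.image_insert, Finset.image_singleton, Finset.mem_insert,
      Finset.mem_singleton]
    omega
  · refine ⟨_, _, 6 * k + 3 - i, step (.w_odd (k - 1 - i) (by omega)), ?_⟩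
    ext w
    simp only [Finset.image_insert, Finset.image_singleton, Finset.mem_insert,
      Finset.mem_singleton]
    omega
  · refine ⟨_, _, 2 * k + 2, step .leftEnd, ?_⟩
    ext w
    simp only [Finset.image_insert, Finset.image_singleton, Finset.mem_insert,
      Finset.mem_singleton]
    omega
  · refine ⟨_, _, 5 * k + 3, step .rightEnd, ?_⟩
    ext w
    simp only [Finset.image_insert, Finset.image_singleton, Finset.mem_insert,
      Finset.mem_singleton]
    omega

end Walk

/-! ### The walk is a single cycle, and the rotation of `R_{k,n}` -/

section RingelRotation

/-- The currents `±1, …, ±(6k+3)`. -/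
noncomputable def ringelCurrents (k : ℕ) : Finset ℤ :=
  (Finset.Icc (-(6 * k + 3 : ℤ)) (6 * k + 3)).erase 0

lemma mem_ringelCurrents {k : ℕ} {a : ℤ} :
    a ∈ ringelCurrents k ↔ a ≠ 0 ∧ -(6 * k + 3) ≤ a ∧ a ≤ 6 * k + 3 := by
  rw [ringelCurrents, Finset.mem_erase, Finset.mem_Icc]

lemma card_ringelCurrents (k : ℕ) : (ringelCurrents k).card = 6 + 12 * k := by
  rw [ringelCurrents, Finset.card_erase_of_mem (by rw [Finset.mem_Icc]; omega), Int.card_Icc]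
  omega

lemma RingelNode.mem_ringelCurrents {k : ℕ} {x y z : ℤ} (h : RingelNode k x y z) :
    x ∈ ringelCurrents k ∧ y ∈ ringelCurrents k ∧ z ∈ ringelCurrents k := by
  simp only [_root_.mem_ringelCurrents]
  cases h <;> omega

lemma neg_mem_ringelCurrents {k : ℕ} {a : ℤ} (h : -a ∈ ringelCurrents k) :
    a ∈ ringelCurrents k := by
  rw [mem_ringelCurrents] at h ⊢
  omega

lemma RingelStep.mem_ringelCurrents {k : ℕ} {a b : ℤ} (h : RingelStep k a b) :
    a ∈ ringelCurrents k ∧ b ∈ ringelCurrents k := by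
  obtain ⟨z, h | h | h⟩ := h <;> obtain ⟨h1, h2, h3⟩ := h.mem_ringelCurrents
  exacts [⟨neg_mem_ringelCurrents h1, h2⟩, ⟨neg_mem_ringelCurrents h3, h1⟩,
    ⟨neg_mem_ringelCurrents h2, h3⟩]

lemma RingelStep.ringelIndex_cast {k : ℕ} {a b : ℤ} (h : RingelStep k a b) :
    (ringelIndex k b : ZMod (6 + 12 * k)) = ringelIndex k a + 1 := by
  have hm : ((6 + 12 * k : ℤ) : ZMod (6 + 12 * k)) = 0 := by
    exact_mod_cast ZMod.natCast_self (6 + 12 * k)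
  rcases h.ringelIndex_eq with h | h
  · rw [h]; push_cast; rfl
  · rw [h, Int.cast_sub, hm]; push_cast; ring

/-- The walk is a single closed walk through all currents: the position in the walk is a
bijection onto the integers modulo `12k+6`. Being onto follows from its growth by one in each step,
and then being one-to-one from the number of currents. -/
lemma bijective_ringelIndex (k : ℕ) : Function.Bijective
    (fun a : ringelCurrents k => (ringelIndex k a : ZMod (6 + 12 * k))) := by
  have : NeZero (6 + 12 * k) := ⟨by omega⟩
  rw [Fintype.bijective_iff_surjective_and_card]
  refine ⟨?_, by rw [Fintype.card_coe, card_ringelCurrents, ZMod.card]⟩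
  have hsucc : ∀ d : ℕ, ∃ a : ringelCurrents k,
      (ringelIndex k a : ZMod (6 + 12 * k)) = ringelIndex k 1 + d := by
    intro d
    induction d with
    | zero => exact ⟨⟨1, by rw [mem_ringelCurrents]; omega⟩, by simp⟩
    | succ d ih =>
      obtain ⟨⟨a, ha⟩, h⟩ := ih
      obtain ⟨h0, h1, h2⟩ := mem_ringelCurrents.1 ha
      obtain ⟨b, hb⟩ := exists_ringelStep h0 h1 h2
      exact ⟨⟨b, hb.mem_ringelCurrents.2⟩, by rw [hb.ringelIndex_cast, h]; push_cast; ring⟩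
  intro x
  obtain ⟨a, ha⟩ := hsucc (x - ringelIndex k 1).val
  exact ⟨a, by simpa using ha⟩

/-- The `j`-th current of the closed walk. -/
noncomputable def ringelWalk (k : ℕ) (j : ZMod (6 + 12 * k)) : ℤ :=
  ((Equiv.ofBijective _ (bijective_ringelIndex k)).symm j).1

variable {k : ℕ}

lemma ringelWalk_mem (j : ZMod (6 + 12 * k)) : ringelWalk k j ∈ ringelCurrents k :=
  ((Equiv.ofBijective _ (bijective_ringelIndex k)).symm j).2

lemma ringelIndex_walk (j : ZMod (6 + 12 * k)) :
    (ringelIndex k (ringelWalk k j) : ZMod (6 + 12 * k)) = j :=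
  (Equiv.ofBijective _ (bijective_ringelIndex k)).apply_symm_apply j

lemma ringelWalk_index {a : ℤ} (ha : a ∈ ringelCurrents k) :
    ringelWalk k (ringelIndex k a : ZMod (6 + 12 * k)) = a :=
  congrArg Subtype.val
    ((Equiv.ofBijective _ (bijective_ringelIndex k)).symm_apply_apply ⟨a, ha⟩)

lemma ringelWalk_injective : Function.Injective (ringelWalk k) := fun i j h => by
  rw [← ringelIndex_walk i, h, ringelIndex_walk]

lemma RingelStep.exists_walk {a b : ℤ} (h : RingelStep k a b) :
    ∃ j, ringelWalk k j = a ∧ ringelWalk k (j + 1) = b :=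
  ⟨ringelIndex k a, ringelWalk_index h.mem_ringelCurrents.1, by
    rw [← h.ringelIndex_cast, ringelWalk_index h.mem_ringelCurrents.2]⟩

lemma ringelStep_walk (j : ZMod (6 + 12 * k)) :
    RingelStep k (ringelWalk k j) (ringelWalk k (j + 1)) := by
  obtain ⟨h0, h1, h2⟩ := mem_ringelCurrents.1 (ringelWalk_mem j)
  obtain ⟨b, hb⟩ := exists_ringelStep h0 h1 h2
  obtain ⟨i, hi, rfl⟩ := hb.exists_walk
  obtain rfl := ringelWalk_injective hi
  exact hb

lemma exists_ringelWalk_eq {a : ℤ} (ha : a ∈ ringelCurrents k) : ∃ j, ringelWalk k j = a :=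
  ⟨_, ringelWalk_index ha⟩

lemma reflTransGen_one_ringelWalk (j : ZMod (6 + 12 * k)) :
    Relation.ReflTransGen (RingelStep k) 1 (ringelWalk k j) := by
  have : NeZero (6 + 12 * k) := ⟨by omega⟩
  obtain ⟨i, hi⟩ := exists_ringelWalk_eq (k := k) (a := 1) (by rw [mem_ringelCurrents]; omega)
  have : ∀ d : ℕ, Relation.ReflTransGen (RingelStep k) 1 (ringelWalk k (i + d)) := by
    intro d
    induction d with
    | zero => rw [Nat.cast_zero, add_zero, hi]
    | succ d ih =>
      rw [Nat.cast_succ, ← add_assoc]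
      exact ih.tail (ringelStep_walk _)
  simpa using this (j - i).val

lemma eq_of_intCast_eq_of_small {n : ℕ} {a b : ℤ} (hn : 7 + 12 * k ≤ n)
    (ha : -(6 * k + 3) ≤ a ∧ a ≤ 6 * k + 3) (hb : -(6 * k + 3) ≤ b ∧ b ≤ 6 * k + 3)
    (h : (a : ZMod n) = b) : a = b := by
  rw [ZMod.intCast_eq_intCast_iff_dvd_sub] at h
  have := Int.eq_zero_of_abs_lt_dvd h (by rw [abs_lt]; omega)
  omega

/-- The rotation at the vertex `0` of `R_{k,n}`: the walk modulo `n`, whose currents are distinct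
modulo `n` since `n ≥ 12k + 7`. -/
noncomputable def ringelRotation (k n : ℕ) (hn : 7 + 12 * k ≤ n) :
    CyclicRotation n (6 + 12 * k) where
  c j := (ringelWalk k j : ZMod n)
  inj i j h := ringelWalk_injective (eq_of_intCast_eq_of_small hn
    (mem_ringelCurrents.1 (ringelWalk_mem i)).2 (mem_ringelCurrents.1 (ringelWalk_mem j)).2 h)
  ne_zero j h := (mem_ringelCurrents.1 (ringelWalk_mem j)).1 (eq_of_intCast_eq_of_small hn
    (mem_ringelCurrents.1 (ringelWalk_mem j)).2 (by omega) (by rw [h, Int.cast_zero]))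
  rot j := by
    obtain ⟨i, h1, h2⟩ := (ringelStep_walk j).rotate.exists_walk
    exact ⟨i, by rw [h1]; push_cast; rfl, by rw [h2]; push_cast; rfl⟩

/-- A cyclic complex depends only on the orbits of its generating simplices. -/
lemma cyclicComplex_le {n : ℕ} {S T : Set (Finset (ZMod n))}
    (h : ∀ s ∈ S, ∃ t ∈ T, ∃ a, s ⊆ t.image (fun v => v + a)) :
    (cyclicComplex n S).faces ⊆ (cyclicComplex n T).faces := by
  rintro s ⟨hs, u, hu, a, hsu⟩
  obtain ⟨t, ht, b, hut⟩ := h u hu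
  refine ⟨hs, t, ht, b + a, hsu.trans ((Finset.image_subset_image hut).trans ?_)⟩
  rw [Finset.image_image]
  simp [Function.comp_def, add_assoc]

lemma image_natCast_eq {n : ℕ} {u : Finset ℕ} {a b d : ℤ}
    (h : u.image (fun p : ℕ => (p : ℤ)) = {d, a + d, b + d}) :
    u.image (fun p : ℕ => (p : ZMod n)) =
      ({0, (a : ZMod n), (b : ZMod n)} : Finset (ZMod n)).image (fun v => v + (d : ZMod n)) := by
  have := congrArg (Finset.image (fun p : ℤ => (p : ZMod n))) h
  rw [Finset.image_image] at this
  simpa [Function.comp_def, Finset.image_insert] using this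

theorem generalizedRingel_eq_complex {n : ℕ} (hn : 7 + 12 * k ≤ n) :
    generalizedRingel k n = (ringelRotation k n hn).complex := by
  refine PreAbstractSimplicialComplex.ext (Set.Subset.antisymm ?_ ?_)
  · refine cyclicComplex_le ?_
    rintro _ ⟨u, hu, rfl⟩
    obtain ⟨a, b, d, hab, h⟩ := exists_ringelStep_of_mem_generatingTriangles hu
    obtain ⟨j, rfl, rfl⟩ := hab.exists_walk
    exact ⟨_, ⟨j, rfl⟩, d, (image_natCast_eq h).subset⟩
  · refine cyclicComplex_le ?_
    rintro _ ⟨j, rfl⟩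
    obtain ⟨u, hu, d, h⟩ := (ringelStep_walk j).exists_generatingTriangle
    refine ⟨_, ⟨u, hu, rfl⟩, -(d : ZMod n), ?_⟩
    rw [image_natCast_eq h, Finset.image_image]
    simp [Function.comp_def, ringelRotation]

theorem ringelSeries_eq_complex (k : ℕ) :
    ringelSeries k = (ringelRotation k (7 + 12 * k) le_rfl).complex := by
  unfold ringelSeries CyclicRotation.complex
  congr 1
  ext t
  constructor
  · rintro ⟨a, b, -, hab, rfl⟩
    obtain ⟨j, rfl, rfl⟩ := hab.exists_walk
    exact ⟨j, rfl⟩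
  · rintro ⟨j, rfl⟩
    exact ⟨_, _, reflTransGen_one_ringelWalk j, ringelStep_walk j, rfl⟩

/-! ### The generating triangles are distinct -/

/-- The pairs `(x, y)` with `0 < x < y` for which `[0, x, y]` is a generating triangle. -/
def generatingPairs (k : ℕ) : Finset (ℕ × ℕ) :=
  (Finset.range k).image (fun i => (2 * i + 1, 3 * k + 3 + i)) ∪
  (Finset.range k).image (fun i => (2 * i + 2, 3 * k + 3 + i)) ∪
  (Finset.range k).image (fun i => (4 * k + 3 + i, 6 * k + 3 - i)) ∪
  (Finset.range k).image (fun i => (4 * k + 4 + i, 6 * k + 3 - i)) ∪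
  {(2 * k + 2, 4 * k + 3), (2 * k + 1, 5 * k + 3)}

lemma generatingTriangles_eq_image (k : ℕ) : generatingTriangles k =
    (generatingPairs k).image (fun p => {0, p.1, p.2}) := by
  simp only [generatingTriangles, generatingPairs, Finset.image_union, Finset.image_image,
    Finset.image_insert, Finset.image_singleton, Function.comp_def]

lemma lt_of_mem_generatingPairs {p : ℕ × ℕ} (hp : p ∈ generatingPairs k) :
    0 < p.1 ∧ p.1 < p.2 ∧ p.2 < 6 * k + 4 := by
  simp only [generatingPairs, Finset.mem_union, Finset.mem_image, Finset.mem_range,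
    Finset.mem_insert, Finset.mem_singleton] at hp
  rcases hp with (((⟨i, hi, rfl⟩ | ⟨i, hi, rfl⟩) | ⟨i, hi, rfl⟩) | ⟨i, hi, rfl⟩) | rfl | rfl <;>
    simp only <;> omega

lemma card_generatingPairs (k : ℕ) : (generatingPairs k).card = 2 + 4 * k := by
  unfold generatingPairs
  rw [Finset.card_union_of_disjoint, Finset.card_union_of_disjoint, Finset.card_union_of_disjoint,
    Finset.card_union_of_disjoint, Finset.card_image_of_injective, Finset.card_image_of_injective,
    Finset.card_image_of_injective, Finset.card_image_of_injective, Finset.card_range,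
    Finset.card_pair]
  · ring
  · simp only [ne_eq, Prod.mk.injEq]; omega
  all_goals first
    | (intro i j h; simp only [Prod.mk.injEq] at h; omega)
    | (rw [Finset.disjoint_left]
       rintro ⟨a, b⟩ h h'
       simp only [Finset.mem_union, Finset.mem_image, Finset.mem_range, Finset.mem_insert,
         Finset.mem_singleton, Prod.mk.injEq] at h h'
       grind)

lemma card_generatingTriangles (k : ℕ) : (generatingTriangles k).card = 2 + 4 * k := by
  rw [generatingTriangles_eq_image, Finset.card_image_of_injOn, card_generatingPairs]
  rintro ⟨a, b⟩ hp ⟨a', b'⟩ hp' h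
  have h1 := lt_of_mem_generatingPairs hp
  have h2 := lt_of_mem_generatingPairs hp'
  have e1 := (Finset.ext_iff.1 h a).1 (by simp)
  have e2 := (Finset.ext_iff.1 h b).1 (by simp)
  have e3 := (Finset.ext_iff.1 h a').2 (by simp)
  simp only [Finset.mem_insert, Finset.mem_singleton] at e1 e2 e3 h1 h2
  rw [Prod.mk.injEq]
  omega

lemma card_and_subset_of_mem_generatingTriangles {t : Finset ℕ} (ht : t ∈ generatingTriangles k) :
    t.card = 3 ∧ t ⊆ Finset.range (6 * k + 4) := by
  rw [generatingTriangles_eq_image, Finset.mem_image] at ht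
  obtain ⟨p, hp, rfl⟩ := ht
  obtain ⟨h1, h2, h3⟩ := lt_of_mem_generatingPairs hp
  refine ⟨Finset.card_eq_three.2 ⟨_, _, _, by omega, by omega, by omega, rfl⟩, ?_⟩
  intro x
  simp only [Finset.mem_insert, Finset.mem_singleton, Finset.mem_range]
  omega

end RingelRotation

/-! ### The cyclic symmetry -/

section Shifts

variable {n : ℕ}

lemma addRight_one_pow_apply (d : ℕ) (v : ZMod n) :
    ((Equiv.addRight (1 : ZMod n)) ^ d) v = v + d := by
  simp

lemma cyclicShifts_le_automorphisms (T : Set (Finset (ZMod n))) :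
    cyclicShifts n ≤ automorphisms (cyclicComplex n T) := by
  rw [cyclicShifts, Subgroup.zpowers_le]
  intro s
  have hmap : s.map (Equiv.addRight (1 : ZMod n)).toEmbedding = s.image (fun v => v + 1) := by
    rw [Finset.map_eq_image]; rfl
  rw [hmap]
  constructor
  · rintro ⟨hs, t, ht, a, h⟩
    refine ⟨Finset.image_nonempty.1 hs, t, ht, a - 1, fun v hv => ?_⟩
    obtain ⟨w, hw, hwv⟩ := Finset.mem_image.1 (h (Finset.mem_image_of_mem _ hv))
    exact Finset.mem_image.2 ⟨w, hw, by rw [← add_sub_assoc, hwv, add_sub_cancel_right]⟩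
  · rintro ⟨hs, t, ht, a, h⟩
    refine ⟨hs.image _, t, ht, a + 1, (Finset.image_subset_image h).trans ?_⟩
    rw [Finset.image_image]
    simp [Function.comp_def, add_assoc]

lemma card_cyclicShifts [NeZero n] : Nat.card (cyclicShifts n) = n := by
  rw [cyclicShifts, Nat.card_zpowers, orderOf_eq_iff (NeZero.pos n)]
  refine ⟨Equiv.ext fun v => by simp, fun d hd hd0 h => ?_⟩
  have := congrArg (fun σ : Equiv.Perm (ZMod n) => σ 0) h
  simp only [addRight_one_pow_apply, zero_add, Equiv.Perm.coe_one, id_eq,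
    ZMod.natCast_eq_zero_iff] at this
  exact absurd (Nat.le_of_dvd hd0 this) (not_le.2 hd)

lemma isPretransitive_cyclicShifts [NeZero n] :
    MulAction.IsPretransitive (cyclicShifts n) (ZMod n) where
  exists_smul_eq v w := by
    refine ⟨⟨Equiv.addRight (1 : ZMod n) ^ (w - v).val, Subgroup.npow_mem_zpowers _ _⟩, ?_⟩
    change (Equiv.addRight (1 : ZMod n) ^ (w - v).val) v = w
    rw [addRight_one_pow_apply]
    simp

lemma generalizedRingel_zero (n : ℕ) : generalizedRingel 0 n = altshulerTorus n := by
  unfold generalizedRingel altshulerTorus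
  congr 1
  ext t
  simp [generatingTriangles, Finset.image_insert]
  tauto

end Shifts

/-! ### Neighborliness -/

/-- With `m = n - 1` neighbours at every vertex, all pairs of vertices are joined. -/
lemma CyclicRotation.isNeighborly {n m : ℕ} [NeZero n] [NeZero m] (R : CyclicRotation n m)
    (h : n = m + 1) : IsNeighborly R.complex := by
  classical
  have himg : Finset.univ.image R.c = Finset.univ.erase 0 := by
    refine Finset.eq_of_subset_of_card_le (fun x hx => ?_) ?_
    · obtain ⟨j, -, rfl⟩ := Finset.mem_image.1 hx
      exact Finset.mem_erase.2 ⟨R.ne_zero j, Finset.mem_univ _⟩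
    · rw [Finset.card_image_of_injective _ R.inj, Finset.card_erase_of_mem (Finset.mem_univ _),
        Finset.card_univ, Finset.card_univ, ZMod.card, ZMod.card]
      omega
  intro v w _ _ hvw
  have : w - v ∈ Finset.univ.image R.c := by
    rw [himg]
    exact Finset.mem_erase.2 ⟨sub_ne_zero.2 hvw.symm, Finset.mem_univ _⟩
  obtain ⟨j, -, hj⟩ := Finset.mem_image.1 this
  exact (R.pair_mem_iff hvw).2 ⟨j, hj⟩

theorem mainTheorem1 :
    (∀ k n : ℕ, 7 + 12 * k ≤ n →
      -- the generating triangles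
      (generatingTriangles k).card = 2 + 4 * k ∧
      (∀ t ∈ generatingTriangles k, t.card = 3 ∧ t ⊆ Finset.range (6 * k + 4)) ∧
      -- a triangulation, on the vertex set `ZMod n`, of the orientable surface of genus `kn + 1`
      TriangulatesOrientableSurface (generalizedRingel k n) (k * n + 1) ∧
      (∀ v : ZMod n, {v} ∈ (generalizedRingel k n).faces) ∧
      -- vertex-transitive cyclic symmetry
      cyclicShifts n ≤ automorphisms (generalizedRingel k n) ∧
      Nat.card (cyclicShifts n) = n ∧
      MulAction.IsPretransitive (cyclicShifts n) (ZMod n) ∧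
      -- equivelar of type `{3, 6 + 12k}`
      IsEquivelar (generalizedRingel k n) (6 + 12 * k) ∧
      -- the `f`-vector, and the same numbers in terms of `q = 6 + 12k`
      faceCount (generalizedRingel k n) 0 = n ∧
      faceCount (generalizedRingel k n) 1 = 3 * (1 + 2 * k) * n ∧
      faceCount (generalizedRingel k n) 2 = 2 * (1 + 2 * k) * n ∧
      (∀ q : ℕ, q = 6 + 12 * k →
        (faceCount (generalizedRingel k n) 1 : ℚ) = n * q / 2 ∧
        (faceCount (generalizedRingel k n) 2 : ℚ) = n * q / 3 ∧
        ((k * n + 1 : ℕ) : ℚ) = 1 + ((q : ℚ) - 6) * n / 12)) ∧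
    -- the two classical special cases
    (∀ n : ℕ, 7 ≤ n → generalizedRingel 0 n = altshulerTorus n) ∧
    (∀ k : ℕ, generalizedRingel k (7 + 12 * k) = ringelSeries k ∧
      IsNeighborly (generalizedRingel k (7 + 12 * k))) := by
  refine ⟨fun k n hn => ?_, fun n _ => generalizedRingel_zero n, fun k => ?_⟩
  · have : NeZero n := ⟨by omega⟩
    have : NeZero (6 + 12 * k) := ⟨by omega⟩
    set R := ringelRotation k n hn with hR
    have h1 := R.two_mul_faceCount_one
    have h2 := R.three_mul_faceCount_two (by omega)
    have hf1 : faceCount R.complex 1 = 3 * (1 + 2 * k) * n := by linarith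
    have hf2 : faceCount R.complex 2 = 2 * (1 + 2 * k) * n := by linarith
    have hshift : cyclicShifts n ≤ automorphisms (generalizedRingel k n) :=
      cyclicShifts_le_automorphisms _
    refine ⟨card_generatingTriangles k, fun t => card_and_subset_of_mem_generatingTriangles, ?_⟩
    rw [generalizedRingel_eq_complex hn] at hshift ⊢
    refine ⟨R.triangulates (by omega) ?_ _ (by ring), R.singleton_mem, hshift, card_cyclicShifts,
      isPretransitive_cyclicShifts, fun v _ => R.vertexDegree_complex v, R.faceCount_zero, hf1,
      hf2, ?_⟩
    · obtain ⟨j, hj⟩ := exists_ringelWalk_eq (k := k) (a := 1) (by rw [mem_ringelCurrents]; omega)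
      exact ⟨j, by simp [hR, ringelRotation, hj]⟩
    · rintro q rfl
      rw [hf1, hf2]
      push_cast
      refine ⟨by ring, by ring, by ring⟩
  · have : NeZero (7 + 12 * k) := ⟨by omega⟩
    have : NeZero (6 + 12 * k) := ⟨by omega⟩
    rw [generalizedRingel_eq_complex le_rfl]
    exact ⟨(ringelSeries_eq_complex k).symm, CyclicRotation.isNeighborly _ (by ring)⟩
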